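/- Let $n\ge 1$ and let $\alpha=(\alpha_1,\dots,\alpha_l)$ be a composition of $n$. **Conventions.** For $\sigma\in\mathfrak S_n$ let $\ell(\sigma)$ be its length with respect to the simple transpositions $s_i=(i,i+1)$, $i\in[n-1]$, and put $\mathrm{Des}_L(\sigma)=\{i:\ell(s_i\sigma)<\ell(\sigma)\}$ and $\mathrm{Des}_R(\sigma)=\{i:\ell(\sigma s_i)<\ell(\sigma)\}$. The left (right) weak Bruhat order $\preceq_L$ ($\preceq_R$) is generated by the relations $\sigma\prec s_i\sigma$ with $i\notin\mathrm{Des}_L(\sigma)$ (respectively $\sigma\prec\sigma s_i$ with $i\notin\mathrm{Des}_R(\sigma)$). For $\sigma\preceq_L\rho$ put $[\sigma,\rho]_L=\{\gamma:\sigma\preceq_L\gamma\preceq_L\rho\}$, and let $\mathrm{Int}(n)$ be the set of all these intervals. Two intervals are equivalent if there is an isomorphism between them for $\preceq_L$ that preserves $\mathrm{Des}_L$. An equivalence class is ordered by $[\sigma,\rho]_L\preceq[\sigma',\rho']_L$ if and only if $\sigma\preceq_R\sigma'$. For $S\subseteq[n-1]$ with complement $S^{c}=[n-1]\setminus S$,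 $w_0(S)$ is the longest element of the subgroup generated by $\{s_i: i\in S\}$, and $w_1(S)$ is the longest element of $\{z\in\mathfrak S_n:\mathrm{Des}_R(z)\subseteq S\}$. For a composition $\beta=(\beta_1,\dots,\beta_k)$ of $n$, $\mathrm{set}(\beta)=\{\beta_1+\dots+\beta_i:1\le i<k\}$, and $\beta^r$ is the reversed composition. $\tilde\alpha$ is the partition obtained by sorting $\alpha$, and $\tilde\alpha'$ is its conjugate partition. A diagram is a set of boxes $(x,y)$, with $x\ge1$ the column (from the left) and $y\ge1$ the row (from the bottom). Let $\mathrm{cd}(\alpha)=\{(x,y):1\le y\le l,\ 1\le x\le\alpha_y\}$, and let $E=\mathrm{cd}(\alpha)^t=\{(y,x):(x,y)\in\mathrm{cd}(\alpha)\}$. For a diagram $D$ or a filling $F$, $D^x$ and $F^x$ denote its reflection in a horizontal line, shifted so that the rows are again numbered from $1$. A standard filling of a diagram with $n$ boxes contains each of $1,\dots,n$ exactly once; it is a standard tableau if $T(i,j)\le T(k,m)$ whenever $i\le k$ and $j\le m$. $\mathrm{ST}(D)$ is the set of standard tableaux on $D$, ordered by $T\le U$ if and only if $\mathrm{read}_{TB,LR}(T)\preceq_L\mathrm{read}_{TB,LR}(U)$,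 where $\mathrm{read}_{TB,LR}$ reads each column from top to bottom, starting with the leftmost column; reading words are regarded as permutations in one-line notation. For a standard filling $F$, $P_F$ is the partial order on $[n]$ with $i\preceq_{P_F}j$ if and only if the box of $i$ is weakly left of and weakly below the box of $j$ in $F$. For a partial order $P$ on $[n]$, $\Sigma_L(P)=\{\sigma\in\mathfrak S_n:\sigma(i)\le\sigma(j)\text{ whenever } i\preceq_P j\}$. The basis $\mathrm{SET}(\alpha)$ of the extended Schur module $X_\alpha$ consists of the standard fillings of $\mathrm{cd}(\alpha)$ whose rows increase from left to right and whose columns increase from bottom to top. Let $\mathrm{read}_{RL,BT}$ read each row from right to left, starting with the bottommost row, and let $\mathrm{read}_{BT,RL}$ read each column from bottom to top, starting with the rightmost column. The tableau $\mathsf{source}_\alpha$ ($\mathsf{sink}_\alpha$) is obtained by filling $\mathrm{cd}(\alpha)$ with $1,\dots,n$ successively along the rows from left to right, starting with the bottommost row (respectively along the columns from bottom to top, starting with the leftmost column). **Proposition.** The set $\{\mathrm{read}_{RL,BT}(T):T\in\mathrm{SET}(\alpha)\}$ belongs to $\mathrm{Int}(n)$. Let $C_{X_\alpha}$ be its equivalence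 class. (a) $C_{X_\alpha}=\{\Sigma_L(P_{T^x}):T\in\mathrm{ST}(E^x)\}$. The minimum and the maximum of $(C_{X_\alpha},\preceq)$ are $$\min C_{X_\alpha}=[w_0(\mathrm{set}(\alpha)^{c}),\ \mathrm{read}_{RL,BT}(\mathsf{sink}_\alpha)]_L,\qquad \max C_{X_\alpha}=[\mathrm{read}_{BT,RL}(\mathsf{source}_\alpha),\ w_1(\mathrm{set}((\tilde\alpha')^{r}))]_L.$$ (b) $(C_{X_\alpha},\preceq)\cong(\mathrm{ST}(E^x),\le)$ as posets. -/

import Mathlib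

/-! Conventions: the set `[n] = {1, …, n}` is modelled by `Fin n` (the number `k + 1` is the
element `k : Fin n`), so `𝔖_n` is `Equiv.Perm (Fin n)` with `(σ * τ) k = σ (τ k)`.  A word with
distinct entries `1, …, n` is the permutation sending `k` to its `k`-th letter.  Indices of simple
transpositions, descents and subset sums keep their usual values in `[n-1] = {1, …, n-1} ⊆ ℕ`. -/

namespace ExtendedSchur

open Equiv

/-! ### Length, descents, weak Bruhat orders -/

/-- The simple transposition `s_i = (i, i+1)` for `1 ≤ i ≤ n - 1` (the identity for other `i`). -/
def simple (n i : ℕ) : Perm (Fin n) :=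
  if h : 1 ≤ i ∧ i < n then swap ⟨i - 1, by omega⟩ ⟨i, h.2⟩ else 1

/-- The length `ℓ(σ)`: the least number of simple transpositions in an expression of `σ`. -/
noncomputable def len {n : ℕ} (σ : Perm (Fin n)) : ℕ :=
  sInf {k | ∃ l : List ℕ,
    (∀ i ∈ l, i ∈ Set.Icc 1 (n - 1)) ∧ l.length = k ∧ (l.map (simple n)).prod = σ}

/-- The left descent set. -/
def desL {n : ℕ} (σ : Perm (Fin n)) : Set ℕ :=
  {i | i ∈ Set.Icc 1 (n - 1) ∧ len (simple n i * σ) < len σ}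

/-- The right descent set. -/
def desR {n : ℕ} (σ : Perm (Fin n)) : Set ℕ :=
  {i | i ∈ Set.Icc 1 (n - 1) ∧ len (σ * simple n i) < len σ}

/-- The left weak Bruhat order, generated by `σ ⋖ s_i σ` for `i ∈ [n-1]` with `i ∉ Des_L(σ)`. -/
def leL {n : ℕ} : Perm (Fin n) → Perm (Fin n) → Prop :=
  Relation.ReflTransGen fun σ τ =>
    ∃ i ∈ Set.Icc 1 (n - 1), i ∉ desL σ ∧ τ = simple n i * σ

/-- The right weak Bruhat order, generated by `σ ⋖ σ s_i` for `i ∈ [n-1]` with `i ∉ Des_R(σ)`. -/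
def leR {n : ℕ} : Perm (Fin n) → Perm (Fin n) → Prop :=
  Relation.ReflTransGen fun σ τ =>
    ∃ i ∈ Set.Icc 1 (n - 1), i ∉ desR σ ∧ τ = σ * simple n i

/-- The (left) weak Bruhat interval `[σ, ρ]_L`. -/
def intervalL {n : ℕ} (σ ρ : Perm (Fin n)) : Set (Perm (Fin n)) :=
  {γ | leL σ γ ∧ leL γ ρ}

/-- The set `Int(n)` of nonempty (left) weak Bruhat intervals. -/
def weakInt (n : ℕ) : Set (Set (Perm (Fin n))) :=
  {I | ∃ σ ρ, leL σ ρ ∧ I = intervalL σ ρ}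

/-! ### The elements `w₀(S)` and `w₁(S)` -/

theorem exists_longest {n : ℕ} (A : Set (Perm (Fin n))) (hA : A.Nonempty) :
    ∃ w ∈ A, ∀ v ∈ A, len v ≤ len w :=
  Set.exists_max_image A len (Set.toFinite A) hA

/-- The parabolic subgroup `𝔖_S` generated by the `s_i`, `i ∈ S`. -/
def parabolic (n : ℕ) (S : Set ℕ) : Subgroup (Perm (Fin n)) :=
  Subgroup.closure {g | ∃ i ∈ S, g = simple n i}

/-- The longest element `w₀(S)` of `𝔖_S`. -/
noncomputable def w0 (n : ℕ) (S : Set ℕ) : Perm (Fin n) :=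
  (exists_longest (parabolic n S : Set (Perm (Fin n))) ⟨1, (parabolic n S).one_mem⟩).choose

/-- The set `𝔖^S = {z | Des_R(z) ⊆ [n-1] \ S}` of minimal length representatives of the left
`𝔖_S`-cosets. -/
def minReps (n : ℕ) (S : Set ℕ) : Set (Perm (Fin n)) :=
  {z | desR z ⊆ Set.Icc 1 (n - 1) \ S}

theorem len_one (n : ℕ) : len (1 : Perm (Fin n)) = 0 :=
  Nat.le_zero.mp (Nat.sInf_le ⟨[], by simp⟩)

theorem one_mem_minReps (n : ℕ) (S : Set ℕ) : (1 : Perm (Fin n)) ∈ minReps n S := by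
  intro i hi
  have h := hi.2
  rw [len_one] at h
  exact absurd h (Nat.not_lt_zero _)

/-- `w₁(S)`, the longest element of `𝔖^{[n-1] \ S}`. -/
noncomputable def w1 (n : ℕ) (S : Set ℕ) : Perm (Fin n) :=
  (exists_longest (minReps n (Set.Icc 1 (n - 1) \ S)) ⟨1, one_mem_minReps n _⟩).choose

/-! ### Descent-preserving equivalence, classes and their order -/

/-- `I₁` and `I₂` are related by a descent-preserving poset isomorphism. -/
def descentEquiv {n : ℕ} (I₁ I₂ : Set (Perm (Fin n))) : Prop :=
  ∃ f : I₁ ≃ I₂, (∀ a b : I₁, leL (a : Perm (Fin n)) b ↔ leL (f a : Perm (Fin n)) (f b)) ∧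
    ∀ a : I₁, desL (a : Perm (Fin n)) = desL (f a : Perm (Fin n))

/-- The equivalence class in `Int(n)` of an interval. -/
def equivClass {n : ℕ} (I : Set (Perm (Fin n))) : Set (Set (Perm (Fin n))) :=
  {J | J ∈ weakInt n ∧ descentEquiv I J}

/-- `[σ, ρ]_L ⪯ [σ', ρ']_L` if and only if `σ ⪯_R σ'`. -/
def intervalLE {n : ℕ} (I J : Set (Perm (Fin n))) : Prop :=
  ∃ σ ρ σ' ρ', leL σ ρ ∧ leL σ' ρ' ∧ I = intervalL σ ρ ∧ J = intervalL σ' ρ' ∧ leR σ σ'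

/-- `A` is the minimum of `(C, ⪯)`. -/
def IsMinOf {n : ℕ} (C : Set (Set (Perm (Fin n)))) (A : Set (Perm (Fin n))) : Prop :=
  A ∈ C ∧ ∀ I ∈ C, intervalLE A I

/-- `A` is the maximum of `(C, ⪯)`. -/
def IsMaxOf {n : ℕ} (C : Set (Set (Perm (Fin n)))) (A : Set (Perm (Fin n))) : Prop :=
  A ∈ C ∧ ∀ I ∈ C, intervalLE I A

/-! ### Diagrams, fillings, reading words

A box is `(x, y)` with `x` its column (from the left) and `y` its row (from the bottom), both
counted from 1. -/

/-- A standard filling of `D` by `1, …, n`, each appearing once. -/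
abbrev StdFilling (D : Finset (ℕ × ℕ)) (n : ℕ) := D ≃ Fin n

/-- A total order on boxes, given by an injective key with values in `ℤ ×ₗ ℤ`. -/
structure BoxOrder where
  key : ℕ × ℕ → ℤ ×ₗ ℤ
  inj : Function.Injective key

/-- Row by row from the bottommost row, each row from left to right. -/
def orderLRBT : BoxOrder where
  key b := toLex ((b.2 : ℤ), (b.1 : ℤ))
  inj a b h := by
    have := toLex.injective h
    simp only [Prod.mk.injEq, Nat.cast_inj] at this
    exact Prod.ext this.2 this.1

/-- Row by row from the bottommost row, each row from right to left. -/
def orderRLBT : BoxOrder where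
  key b := toLex ((b.2 : ℤ), -(b.1 : ℤ))
  inj a b h := by
    have := toLex.injective h
    simp only [Prod.mk.injEq, Nat.cast_inj, neg_inj] at this
    exact Prod.ext this.2 this.1

/-- Column by column from the leftmost column, each column from bottom to top. -/
def orderBTLR : BoxOrder where
  key b := toLex ((b.1 : ℤ), (b.2 : ℤ))
  inj a b h := by
    have := toLex.injective h
    simp only [Prod.mk.injEq, Nat.cast_inj] at this
    exact Prod.ext this.1 this.2

/-- Column by column from the leftmost column, each column from top to bottom. -/
def orderTBLR : BoxOrder where
  key b := toLex ((b.1 : ℤ), -(b.2 : ℤ))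
  inj a b h := by
    have := toLex.injective h
    simp only [Prod.mk.injEq, Nat.cast_inj, neg_inj] at this
    exact Prod.ext this.1 this.2

/-- Column by column from the rightmost column, each column from bottom to top. -/
def orderBTRL : BoxOrder where
  key b := toLex (-(b.1 : ℤ), (b.2 : ℤ))
  inj a b h := by
    have := toLex.injective h
    simp only [Prod.mk.injEq, Nat.cast_inj, neg_inj] at this
    exact Prod.ext this.1 this.2

/-- The bijection from `D` to the set of its keys. -/
noncomputable def keyEquiv (o : BoxOrder) (D : Finset (ℕ × ℕ)) : D ≃ D.image o.key :=
  (Equiv.Set.imageOfInjOn o.key D o.inj.injOn).trans (Equiv.setCongr (by simp))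

theorem keyEquiv_apply (o : BoxOrder) (D : Finset (ℕ × ℕ)) (b : D) :
    (keyEquiv o D b : ℤ ×ₗ ℤ) = o.key b := rfl

/-- The standard filling of `D` by `1, 2, …, n` placed successively in the given order. -/
noncomputable def seqFilling (o : BoxOrder) (D : Finset (ℕ × ℕ)) {n : ℕ} (h : D.card = n) :
    StdFilling D n :=
  (keyEquiv o D).trans
    ((D.image o.key).orderIsoOfFin ((Finset.card_image_of_injective D o.inj).trans h)).symm.toEquiv

theorem StdFilling.card_eq {D : Finset (ℕ × ℕ)} {n : ℕ} (F : StdFilling D n) : D.card = n := by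
  simpa using Fintype.card_congr F

/-- The reading word of `F`, reading the boxes in the given order, as a permutation: its `k`-th
letter is the entry of `F` in the `k`-th box. -/
noncomputable def readWord (o : BoxOrder) {D : Finset (ℕ × ℕ)} {n : ℕ} (F : StdFilling D n) :
    Perm (Fin n) :=
  (seqFilling o D F.card_eq).symm.trans F

/-- The defining property of `seqFilling`. -/
theorem seqFilling_lt_iff (o : BoxOrder) (D : Finset (ℕ × ℕ)) {n : ℕ} (h : D.card = n) (b c : D) :
    seqFilling o D h b < seqFilling o D h c ↔ o.key b < o.key c :=
  ((D.image o.key).orderIsoOfFin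
    ((Finset.card_image_of_injective D o.inj).trans h)).symm.lt_iff_lt

/-- Standard tableaux on `D`: standard fillings with `T(i,j) ≤ T(k,l)` whenever `i ≤ k`, `j ≤ l`. -/
def stdTableaux (D : Finset (ℕ × ℕ)) (n : ℕ) : Set (StdFilling D n) :=
  {T | ∀ b c : D, (b : ℕ × ℕ).1 ≤ (c : ℕ × ℕ).1 → (b : ℕ × ℕ).2 ≤ (c : ℕ × ℕ).2 → T b ≤ T c}

/-- The order on tableaux: `T ≤ U` iff `read_TBLR(T) ⪯_L read_TBLR(U)`. -/
def tableauLE {D : Finset (ℕ × ℕ)} {n : ℕ} (T U : StdFilling D n) : Prop :=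
  leL (readWord orderTBLR T) (readWord orderTBLR U)

/-- The poset `P_F` on `[n]`: `i ⪯ j` iff the box of `i` is weakly left of and weakly below the
box of `j` in `F`. -/
abbrev fillingPoset {D : Finset (ℕ × ℕ)} {n : ℕ} (F : StdFilling D n) : PartialOrder (Fin n) :=
  PartialOrder.lift (fun i => ((F.symm i : D) : ℕ × ℕ))
    (Subtype.val_injective.comp F.symm.injective)

/-- `Σ_L(P)`: the permutations `σ` with `σ(i) ≤ σ(j)` whenever `i ⪯_P j`. -/
def linExt {n : ℕ} (P : PartialOrder (Fin n)) : Set (Perm (Fin n)) :=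
  {σ | ∀ i j, P.le i j → σ i ≤ σ j}

/-- Reflection of a box across a horizontal line, exchanging row `1` with the topmost row of
`D`. -/
def flipBox (D : Finset (ℕ × ℕ)) (b : ℕ × ℕ) : ℕ × ℕ := (b.1, D.sup Prod.snd + 1 - b.2)

theorem flipBox_injOn (D : Finset (ℕ × ℕ)) : Set.InjOn (flipBox D) D := by
  intro a ha b hb h
  have h1 : a.2 ≤ D.sup Prod.snd := Finset.le_sup (f := Prod.snd) ha
  have h2 : b.2 ≤ D.sup Prod.snd := Finset.le_sup (f := Prod.snd) hb
  simp only [flipBox, Prod.mk.injEq] at h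
  exact Prod.ext h.1 (by omega)

/-- The reflected diagram `D^x`. -/
def reflectX (D : Finset (ℕ × ℕ)) : Finset (ℕ × ℕ) := D.image (flipBox D)

/-- The bijection of boxes `D ≃ D^x`. -/
noncomputable def reflectEquiv (D : Finset (ℕ × ℕ)) : D ≃ reflectX D :=
  (Equiv.Set.imageOfInjOn (flipBox D) D (flipBox_injOn D)).trans
    (Equiv.setCongr (by simp [reflectX]))

theorem reflectEquiv_apply (D : Finset (ℕ × ℕ)) (b : D) :
    (reflectEquiv D b : ℕ × ℕ) = flipBox D b := rfl

/-- The reflected filling `F^x` of `D^x`. -/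
noncomputable def reflectFilling {D : Finset (ℕ × ℕ)} {n : ℕ} (F : StdFilling D n) :
    StdFilling (reflectX D) n :=
  (reflectEquiv D).symm.trans F

/-! ### Compositions and standard extended tableaux -/

/-- `set(L) = {L₁, L₁ + L₂, …, L₁ + ⋯ + L_{l-1}}` for a composition given by its list of parts. -/
def partialSums (L : List ℕ) : Set ℕ :=
  {s | ∃ i, 1 ≤ i ∧ i < L.length ∧ s = (L.take i).sum}

/-- The composition diagram `cd(α)`, with `α_i` left-justified boxes in the `i`-th row from the
bottom. -/
def compDiagram {n : ℕ} (α : Composition n) : Finset (ℕ × ℕ) :=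
  (Finset.univ : Finset (Σ i : Fin α.length, Fin (α.blocksFun i))).image
    fun p => ((p.2 : ℕ) + 1, (p.1 : ℕ) + 1)

theorem card_compDiagram {n : ℕ} (α : Composition n) : (compDiagram α).card = n := by
  rw [compDiagram, Finset.card_image_of_injective]
  · simp [α.sum_blocksFun]
  · rintro ⟨i, a⟩ ⟨j, b⟩ h
    simp only [Prod.mk.injEq, add_left_inj] at h
    obtain rfl : i = j := Fin.ext h.2
    obtain rfl : a = b := Fin.ext h.1
    rfl

/-- The transposed diagram `D^t`. -/
def transposeDiagram (D : Finset (ℕ × ℕ)) : Finset (ℕ × ℕ) := D.image Prod.swap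

/-- The standard extended tableaux of shape `α`: standard fillings of `cd(α)` whose rows increase
from left to right and whose columns increase from bottom to top. -/
def SET {n : ℕ} (α : Composition n) : Set (StdFilling (compDiagram α) n) :=
  {T | ∀ b c : compDiagram α,
    ((b : ℕ × ℕ).2 = (c : ℕ × ℕ).2 → (b : ℕ × ℕ).1 < (c : ℕ × ℕ).1 → T b < T c) ∧
    ((b : ℕ × ℕ).1 = (c : ℕ × ℕ).1 → (b : ℕ × ℕ).2 < (c : ℕ × ℕ).2 → T b < T c)}

/-- The source tableau: `1, …, n` along rows, left to right, from the bottommost row. -/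
noncomputable def sourceSET {n : ℕ} (α : Composition n) : StdFilling (compDiagram α) n :=
  seqFilling orderLRBT (compDiagram α) (card_compDiagram α)

/-- The sink tableau: `1, …, n` along columns, bottom to top, from the leftmost column. -/
noncomputable def sinkSET {n : ℕ} (α : Composition n) : StdFilling (compDiagram α) n :=
  seqFilling orderBTLR (compDiagram α) (card_compDiagram α)

/-- The set of reading words (rows from right to left, starting with the bottommost row) of the
tableau basis `SET(α)` of the extended Schur module `X_α`. -/
def readingWords {n : ℕ} (α : Composition n) : Set (Perm (Fin n)) :=
  {σ | ∃ T ∈ SET α, σ = readWord orderRLBT T}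

/-- The class `C_{X_α}`. -/
def classX {n : ℕ} (α : Composition n) : Set (Set (Perm (Fin n))) :=
  equivClass (readingWords α)

/-- The partition `α̃` obtained by sorting the parts of `α`, as a Young diagram. -/
def sortedDiagram {n : ℕ} (α : Composition n) : YoungDiagram :=
  YoungDiagram.ofRowLens (α.blocks.insertionSort (· ≥ ·)) α.blocks.sortedGE_insertionSort

/-- The parts of `(α̃')^r`: the conjugate partition of `α̃`, with its parts in reverse order. -/
def conjRev {n : ℕ} (α : Composition n) : List ℕ :=
  (sortedDiagram α).transpose.rowLens.reverse

end ExtendedSchur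

open ExtendedSchur

/-! The left weak order is containment of inversion sets (`leL_iff`), so every comparison of words
becomes a comparison of pairs of boxes of `compDiagram α`. Call a labelling of the boxes
anti-standard if it increases towards the upper left (`antiTableaux`). For an anti-standard `lam`,
the words `T ∘ lam⁻¹` of the standard tableaux `T` form the interval from the row filling to the
column filling (`extWords_eq_intervalL`): standardness orders boxes in southwest-northeast position,
`lam` orders those in northwest-southeast position. The reading words of the module are the case
where `lam` fills rows from right to left.

A descent-preserving isomorphism has to follow the covers `σ ⋖ s_i σ` with their index `i`, hence is
right multiplication by a fixed permutation (`descentEquiv_apply`), which amounts to replacing `lam`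
by another labelling `mu`. The descents of the two end points, together with their comparability,
force `mu` to be anti-standard (`mem_antiTableaux_of_desL`). Conversely every anti-standard `mu`
gives an equivalent interval (`descentEquiv_extWords`): two such labellings can disagree only on
boxes in strict southwest-northeast position, and the corner box present in left-justified rows
keeps such boxes from holding consecutive entries. Thus the class is parametrised by anti-standard
labellings, and a quarter turn makes these the standard tableaux on `E^x`.

The order on the class compares bottoms `row ∘ mu⁻¹` for the right order, hence their inverses `mu ∘
row⁻¹` for the left order. These are the column reading words of the turned tableaux, which gives
(b). The extreme labellings fill rows, respectively columns, from right to left. The bottom of the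
first interval reverses each row block and the top of the second reverses the order of the column
blocks; these are `w0` and `w1` (`w0_eq`, `w1_eq`). -/

namespace ExtendedSchur

open Equiv

/-! ### Inversions, length and the weak orders -/

/-- The inversions of `σ`, as pairs of positions. -/
def inversions {n : ℕ} (σ : Perm (Fin n)) : Finset (Fin n × Fin n) :=
  Finset.univ.filter fun p => p.1 < p.2 ∧ σ p.2 < σ p.1

theorem mem_inversions {n : ℕ} {σ : Perm (Fin n)} {a b : Fin n} :
    (a, b) ∈ inversions σ ↔ a < b ∧ σ b < σ a := by
  simp [inversions]

theorem mem_Icc_pred {n i : ℕ} : i ∈ Set.Icc 1 (n - 1) ↔ 1 ≤ i ∧ i < n := by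
  simp only [Set.mem_Icc]; omega

theorem perm_apply_inv {n : ℕ} (σ : Perm (Fin n)) (a : Fin n) : σ (σ⁻¹ a) = a :=
  σ.apply_symm_apply a

theorem perm_eq_one_of_strictMono {n : ℕ} {σ : Perm (Fin n)} (h : StrictMono σ) : σ = 1 := by
  have : h.orderIsoOfSurjective σ σ.surjective = OrderIso.refl _ := Subsingleton.elim _ _
  ext a
  exact congrArg Fin.val (DFunLike.congr_fun this a)

theorem strictMono_of_lt_succ {n : ℕ} {α : Type*} [Preorder α] {f : Fin n → α}
    (h : ∀ i (h1 : 1 ≤ i) (h2 : i < n), f ⟨i - 1, by omega⟩ < f ⟨i, h2⟩) : StrictMono f := by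
  cases n with
  | zero => exact fun a => a.elim0
  | succ m =>
    rw [Fin.strictMono_iff_lt_succ]
    intro i
    exact h (i + 1) (by omega) (by omega)

theorem fin_le_of_consecutive {n : ℕ} {α : Type*} [Preorder α] {g : Fin n → α} {a b : Fin n}
    (hab : a ≤ b)
    (h : ∀ d e : Fin n, a ≤ d → e ≤ b → (d : ℕ) + 1 = e → g d ≤ g e) : g a ≤ g b := by
  generalize hk : (b : ℕ) - a = k
  induction k generalizing b with
  | zero =>
    rw [Fin.le_def] at hab
    rw [Fin.ext (by omega : (a : ℕ) = b)]
  | succ k ih =>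
    have hd : ((⟨(b : ℕ) - 1, by omega⟩ : Fin n) : ℕ) + 1 = b := by simp; omega
    generalize (⟨(b : ℕ) - 1, by omega⟩ : Fin n) = d at hd
    refine (ih (b := d) ?_ (fun d' e h1 h2 h3 => h d' e h1 (h2.trans ?_) h3) (by omega)).trans
      (h d b ?_ le_rfl hd) <;> rw [Fin.le_def] <;> omega

theorem simple_eq {n i : ℕ} (h1 : 1 ≤ i) (h2 : i < n) :
    simple n i = swap ⟨i - 1, by omega⟩ ⟨i, h2⟩ := by
  simp [simple, h1, h2]

theorem simple_mul_self (n i : ℕ) : simple n i * simple n i = 1 := by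
  unfold simple
  split_ifs <;> simp

theorem simple_inv (n i : ℕ) : (simple n i)⁻¹ = simple n i :=
  inv_eq_of_mul_eq_one_left (simple_mul_self n i)

/-- Exchanging two adjacent values alters the relative order of no pair of positions except the two
that hold them. -/
theorem inversions_simple_mul {n i : ℕ} {σ : Perm (Fin n)} (h1 : 1 ≤ i) (h2 : i < n)
    (h : σ⁻¹ ⟨i - 1, by omega⟩ < σ⁻¹ ⟨i, h2⟩) :
    inversions (simple n i * σ) =
      insert (σ⁻¹ ⟨i - 1, by omega⟩, σ⁻¹ ⟨i, h2⟩) (inversions σ) := by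
  ext ⟨a, b⟩
  obtain ⟨u, rfl⟩ := σ⁻¹.surjective a
  obtain ⟨v, rfl⟩ := σ⁻¹.surjective b
  simp only [Finset.mem_insert, mem_inversions, Prod.mk.injEq, simple_eq h1 h2, Perm.mul_apply,
    perm_apply_inv, EmbeddingLike.apply_eq_iff_eq, swap_apply_def]
  by_cases hu : u = ⟨i - 1, by omega⟩ <;> by_cases hu' : u = ⟨i, h2⟩ <;>
  by_cases hv : v = ⟨i - 1, by omega⟩ <;> by_cases hv' : v = ⟨i, h2⟩ <;>
  simp only [hu, hu', hv, hv', if_true, if_false, Fin.lt_def, Fin.ext_iff] at * <;>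
  grind

theorem pair_notMem_inversions {n i : ℕ} {σ : Perm (Fin n)} (h1 : 1 ≤ i) (h2 : i < n) :
    (σ⁻¹ ⟨i - 1, by omega⟩, σ⁻¹ ⟨i, h2⟩) ∉ inversions σ := by
  rw [mem_inversions]
  simp only [perm_apply_inv, Fin.lt_def]
  omega

theorem card_inversions_simple_mul {n i : ℕ} {σ : Perm (Fin n)} (h1 : 1 ≤ i) (h2 : i < n)
    (h : σ⁻¹ ⟨i - 1, by omega⟩ < σ⁻¹ ⟨i, h2⟩) :
    (inversions (simple n i * σ)).card = (inversions σ).card + 1 := by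
  rw [inversions_simple_mul h1 h2 h,
    Finset.card_insert_of_notMem (pair_notMem_inversions h1 h2)]

theorem simple_mul_inv_apply {n i : ℕ} (σ : Perm (Fin n)) (h1 : 1 ≤ i) (h2 : i < n) :
    (simple n i * σ)⁻¹ ⟨i - 1, by omega⟩ = σ⁻¹ ⟨i, h2⟩ ∧
      (simple n i * σ)⁻¹ ⟨i, h2⟩ = σ⁻¹ ⟨i - 1, by omega⟩ := by
  rw [mul_inv_rev, simple_inv, simple_eq h1 h2]
  simp

theorem card_inversions_simple_mul' {n i : ℕ} {σ : Perm (Fin n)} (h1 : 1 ≤ i) (h2 : i < n)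
    (h : σ⁻¹ ⟨i, h2⟩ < σ⁻¹ ⟨i - 1, by omega⟩) :
    (inversions σ).card = (inversions (simple n i * σ)).card + 1 := by
  have h3 := simple_mul_inv_apply σ h1 h2
  have := card_inversions_simple_mul (σ := simple n i * σ) h1 h2 (by rw [h3.1, h3.2]; exact h)
  rwa [← mul_assoc, simple_mul_self, one_mul] at this

theorem inv_lt_or_lt {n i : ℕ} (σ : Perm (Fin n)) (h1 : 1 ≤ i) (h2 : i < n) :
    σ⁻¹ ⟨i - 1, by omega⟩ < σ⁻¹ ⟨i, h2⟩ ∨ σ⁻¹ ⟨i, h2⟩ < σ⁻¹ ⟨i - 1, by omega⟩ := by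
  apply lt_or_gt_of_ne
  simp only [ne_eq, EmbeddingLike.apply_eq_iff_eq, Fin.mk.injEq]
  omega

theorem inversions_one (n : ℕ) : inversions (1 : Perm (Fin n)) = ∅ := by
  ext ⟨a, b⟩
  simp only [mem_inversions, Perm.one_apply, Finset.notMem_empty, iff_false, not_and, not_lt]
  exact le_of_lt

/-! ### Length equals the number of inversions -/

theorem card_inversions_prod_le {n : ℕ} (l : List ℕ) (hl : ∀ i ∈ l, i ∈ Set.Icc 1 (n - 1)) :
    (inversions (l.map (simple n)).prod).card ≤ l.length := by
  induction l with
  | nil => simp [inversions_one]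
  | cons i l ih =>
    have ih := ih fun j hj => hl j (List.mem_cons_of_mem _ hj)
    obtain ⟨h1, h2⟩ := mem_Icc_pred.1 (hl i List.mem_cons_self)
    simp only [List.map_cons, List.prod_cons, List.length_cons]
    rcases inv_lt_or_lt (l.map (simple n)).prod h1 h2 with h | h
    · rw [card_inversions_simple_mul h1 h2 h]; omega
    · have := card_inversions_simple_mul' h1 h2 h
      omega

/-- Bubble sort: a permutation without a left descent is the identity, and undoing a left descent
removes exactly one inversion. -/
theorem exists_word {n : ℕ} (k : ℕ) : ∀ σ : Perm (Fin n), (inversions σ).card = k →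
    ∃ l : List ℕ, (∀ i ∈ l, i ∈ Set.Icc 1 (n - 1)) ∧ l.length = k ∧
      (l.map (simple n)).prod = σ := by
  induction k with
  | zero =>
    intro σ hσ
    refine ⟨[], by simp, rfl, ?_⟩
    have hσ' : σ⁻¹ = 1 := by
      refine perm_eq_one_of_strictMono (strictMono_of_lt_succ fun i h1 h2 => ?_)
      rcases inv_lt_or_lt σ h1 h2 with h | h
      · exact h
      · have := card_inversions_simple_mul' h1 h2 h
        omega
    simpa using (inv_eq_one.1 hσ').symm
  | succ k ih =>
    intro σ hσ
    by_cases hex : ∃ i, ∃ (h1 : 1 ≤ i) (h2 : i < n), σ⁻¹ ⟨i, h2⟩ < σ⁻¹ ⟨i - 1, by omega⟩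
    · obtain ⟨i, h1, h2, h⟩ := hex
      have := card_inversions_simple_mul' h1 h2 h
      obtain ⟨l, hl, hlen, hprod⟩ := ih (simple n i * σ) (by omega)
      refine ⟨i :: l, ?_, by simp [hlen], ?_⟩
      · simp only [List.mem_cons, forall_eq_or_imp]
        exact ⟨mem_Icc_pred.2 ⟨h1, h2⟩, hl⟩
      · simp [hprod, ← mul_assoc, simple_mul_self]
    · exfalso
      have hσ' : σ⁻¹ = 1 := by
        refine perm_eq_one_of_strictMono (strictMono_of_lt_succ fun i h1 h2 => ?_)
        rcases inv_lt_or_lt σ h1 h2 with h | h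
        · exact h
        · exact absurd ⟨i, h1, h2, h⟩ hex
      rw [inv_eq_one.1 hσ', inversions_one] at hσ
      simp at hσ

theorem len_eq_card_inversions {n : ℕ} (σ : Perm (Fin n)) : len σ = (inversions σ).card := by
  apply le_antisymm
  · exact Nat.sInf_le (exists_word _ σ rfl)
  · obtain ⟨l, hl, hlen, hprod⟩ := Nat.sInf_mem (s := {k | ∃ l : List ℕ,
      (∀ i ∈ l, i ∈ Set.Icc 1 (n - 1)) ∧ l.length = k ∧ (l.map (simple n)).prod = σ})
      ⟨_, exists_word _ σ rfl⟩
    have := card_inversions_prod_le l hl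
    rw [hprod, hlen] at this
    exact this

theorem mem_desL {n i : ℕ} {σ : Perm (Fin n)} (h1 : 1 ≤ i) (h2 : i < n) :
    i ∈ desL σ ↔ σ⁻¹ ⟨i, h2⟩ < σ⁻¹ ⟨i - 1, by omega⟩ := by
  simp only [desL, Set.mem_ofPred_eq, mem_Icc_pred, h1, h2, true_and, and_self,
    len_eq_card_inversions]
  rcases inv_lt_or_lt σ h1 h2 with h | h
  · have := card_inversions_simple_mul h1 h2 h
    simp only [not_lt_of_gt h, iff_false]
    omega
  · have := card_inversions_simple_mul' h1 h2 h
    simp only [h, iff_true]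
    omega

theorem bounds_of_mem_desL {n i : ℕ} {σ : Perm (Fin n)} (h : i ∈ desL σ) : 1 ≤ i ∧ i < n :=
  mem_Icc_pred.1 h.1

theorem not_mem_desL {n i : ℕ} {σ : Perm (Fin n)} (h1 : 1 ≤ i) (h2 : i < n) :
    i ∉ desL σ ↔ σ⁻¹ ⟨i - 1, by omega⟩ < σ⁻¹ ⟨i, h2⟩ := by
  rw [mem_desL h1 h2]
  have := inv_lt_or_lt σ h1 h2
  grind

/-! ### The weak orders through inversion sets -/

theorem eq_of_inversions_subset_of_covers {n : ℕ} {σ τ : Perm (Fin n)}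
    (h : inversions σ ⊆ inversions τ)
    (hcov : ∀ i (h1 : 1 ≤ i) (h2 : i < n), σ⁻¹ ⟨i - 1, by omega⟩ < σ⁻¹ ⟨i, h2⟩ →
      (σ⁻¹ ⟨i - 1, by omega⟩, σ⁻¹ ⟨i, h2⟩) ∉ inversions τ) : σ = τ := by
  have : τ * σ⁻¹ = 1 := by
    refine perm_eq_one_of_strictMono (strictMono_of_lt_succ fun i h1 h2 => ?_)
    rcases inv_lt_or_lt σ h1 h2 with hlt | hlt
    · have := hcov i h1 h2 hlt
      rw [mem_inversions] at this
      simp only [hlt, true_and, not_lt] at this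
      refine lt_of_le_of_ne this ?_
      simp only [Perm.mul_apply, ne_eq, EmbeddingLike.apply_eq_iff_eq, Fin.mk.injEq]
      omega
    · have h3 : (σ⁻¹ ⟨i, h2⟩, σ⁻¹ ⟨i - 1, by omega⟩) ∈ inversions σ := by
        rw [mem_inversions]
        simp only [perm_apply_inv, Fin.lt_def]
        exact ⟨hlt, by omega⟩
      exact (mem_inversions.1 (h h3)).2
  exact (mul_inv_eq_one.1 this).symm

theorem inversions_injective {n : ℕ} :
    Function.Injective (inversions : Perm (Fin n) → Finset (Fin n × Fin n)) := by
  intro σ τ h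
  refine eq_of_inversions_subset_of_covers h.subset fun i h1 h2 _ => ?_
  rw [← h]
  exact pair_notMem_inversions h1 h2

theorem leL_iff {n : ℕ} {σ τ : Perm (Fin n)} : leL σ τ ↔ inversions σ ⊆ inversions τ := by
  constructor
  · intro h
    induction h with
    | refl => exact subset_rfl
    | tail _ hstep ih =>
      obtain ⟨i, hi, hd, rfl⟩ := hstep
      obtain ⟨h1, h2⟩ := mem_Icc_pred.1 hi
      rw [inversions_simple_mul h1 h2 ((not_mem_desL h1 h2).1 hd)]
      exact ih.trans (Finset.subset_insert _ _)
  · generalize hk : (inversions τ).card - (inversions σ).card = k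
    intro h
    induction k generalizing σ with
    | zero =>
      rw [inversions_injective (Finset.eq_of_subset_of_card_le h (by omega))]
      exact Relation.ReflTransGen.refl
    | succ k ih =>
      by_contra hcon
      -- A cover of `σ` whose new inversion belongs to `τ` would, by induction, give a chain up to
      -- `τ`. If none exists, `σ = τ`, against the positive difference of inversion counts.
      have : σ = τ := by
        refine eq_of_inversions_subset_of_covers h fun i h1 h2 hlt hmem => hcon ?_
        refine Relation.ReflTransGen.head (b := simple n i * σ)
          ⟨i, mem_Icc_pred.2 ⟨h1, h2⟩, (not_mem_desL h1 h2).2 hlt, rfl⟩ (ih ?_ ?_)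
        · rw [card_inversions_simple_mul h1 h2 hlt]
          omega
        · rw [inversions_simple_mul h1 h2 hlt]
          exact Finset.insert_subset hmem h
      subst this
      omega

theorem leL_iff_forall {n : ℕ} {σ τ : Perm (Fin n)} :
    leL σ τ ↔ ∀ a b, a < b → σ b < σ a → τ b < τ a := by
  rw [leL_iff]
  constructor
  · intro h a b hab hσ
    exact (mem_inversions.1 (h (mem_inversions.2 ⟨hab, hσ⟩))).2
  · rintro h ⟨a, b⟩ hab
    rw [mem_inversions] at hab ⊢
    exact ⟨hab.1, h a b hab.1 hab.2⟩

theorem leL_refl {n : ℕ} (σ : Perm (Fin n)) : leL σ σ := Relation.ReflTransGen.refl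

theorem leL_trans {n : ℕ} {σ τ ρ : Perm (Fin n)} (h1 : leL σ τ) (h2 : leL τ ρ) : leL σ ρ :=
  Relation.ReflTransGen.trans h1 h2

theorem leL_antisymm {n : ℕ} {σ τ : Perm (Fin n)} (h1 : leL σ τ) (h2 : leL τ σ) : σ = τ :=
  inversions_injective ((leL_iff.1 h1).antisymm (leL_iff.1 h2))

theorem len_inv {n : ℕ} (σ : Perm (Fin n)) : len σ⁻¹ = len σ := by
  rw [len_eq_card_inversions, len_eq_card_inversions]
  refine Finset.card_bij' (fun p _ => (σ⁻¹ p.2, σ⁻¹ p.1)) (fun p _ => (σ p.2, σ p.1)) ?_ ?_ ?_ ?_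
  · rintro ⟨a, b⟩ h
    rw [mem_inversions] at h ⊢
    simpa using h.symm
  · rintro ⟨a, b⟩ h
    rw [mem_inversions] at h ⊢
    simpa using h.symm
  · rintro ⟨a, b⟩ _
    simp
  · rintro ⟨a, b⟩ _
    simp

theorem desR_eq {n : ℕ} (σ : Perm (Fin n)) : desR σ = desL σ⁻¹ := by
  ext i
  simp only [desR, desL, Set.mem_ofPred_eq]
  rw [← len_inv (σ * simple n i), len_inv σ, mul_inv_rev, simple_inv]

theorem mem_desR {n i : ℕ} {σ : Perm (Fin n)} (h1 : 1 ≤ i) (h2 : i < n) :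
    i ∈ desR σ ↔ σ ⟨i, h2⟩ < σ ⟨i - 1, by omega⟩ := by
  rw [desR_eq, mem_desL h1 h2, inv_inv]

theorem leR_iff {n : ℕ} {σ τ : Perm (Fin n)} : leR σ τ ↔ leL σ⁻¹ τ⁻¹ := by
  constructor
  · refine Relation.ReflTransGen.lift (fun σ : Perm (Fin n) => σ⁻¹) ?_ _ _
    rintro a b ⟨i, hi, hd, rfl⟩
    exact ⟨i, hi, by rwa [← desR_eq], by simp only [mul_inv_rev, simple_inv]⟩
  · intro h
    have := Relation.ReflTransGen.lift (p := fun σ τ : Perm (Fin n) =>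
      ∃ i ∈ Set.Icc 1 (n - 1), i ∉ desR σ ∧ τ = σ * simple n i) (fun σ => σ⁻¹) ?_ _ _ h
    · rw [Function.onFun, inv_inv, inv_inv] at this
      exact this
    · rintro a b ⟨i, hi, hd, rfl⟩
      exact ⟨i, hi, by rwa [desR_eq, inv_inv], by simp only [mul_inv_rev, simple_inv]⟩

/-! ### Intervals and their end points -/

theorem intervalL_eq_iff {n : ℕ} {σ ρ σ' ρ' : Perm (Fin n)} (h : leL σ ρ) (h' : leL σ' ρ')
    (heq : intervalL σ ρ = intervalL σ' ρ') : σ = σ' ∧ ρ = ρ' := by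
  have a1 : σ ∈ intervalL σ' ρ' := heq ▸ ⟨leL_refl _, h⟩
  have a2 : ρ ∈ intervalL σ' ρ' := heq ▸ ⟨h, leL_refl _⟩
  have a3 : σ' ∈ intervalL σ ρ := heq ▸ ⟨leL_refl _, h'⟩
  have a4 : ρ' ∈ intervalL σ ρ := heq ▸ ⟨h', leL_refl _⟩
  exact ⟨leL_antisymm a3.1 a1.1, leL_antisymm a2.2 a4.2⟩

theorem intervalLE_iff {n : ℕ} {σ ρ σ' ρ' : Perm (Fin n)} (h : leL σ ρ) (h' : leL σ' ρ') :
    intervalLE (intervalL σ ρ) (intervalL σ' ρ') ↔ leR σ σ' := by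
  constructor
  · rintro ⟨a, b, a', b', hab, hab', e1, e2, hle⟩
    rw [(intervalL_eq_iff h hab e1).1, (intervalL_eq_iff h' hab' e2).1]
    exact hle
  · intro hle
    exact ⟨σ, ρ, σ', ρ', h, h', rfl, rfl, hle⟩

/-! ### Descent-preserving isomorphisms are right multiplications -/

/-- Passing to `s_i γ` moves the value `i + 1` to an earlier position and `i` to a later one, which
cannot create a descent at `i + 1` or `i - 1`. -/
theorem eq_of_mem_desL_simple_mul {n i j : ℕ} {γ : Perm (Fin n)} (h1 : 1 ≤ i) (h2 : i < n)
    (hi : i ∉ desL γ) (hj : j ∉ desL γ) (hj' : j ∈ desL (simple n i * γ)) : j = i := by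
  obtain ⟨k1, k2⟩ := bounds_of_mem_desL hj'
  rw [not_mem_desL h1 h2] at hi
  rw [not_mem_desL k1 k2] at hj
  rw [mem_desL k1 k2, mul_inv_rev, simple_inv, simple_eq h1 h2] at hj'
  simp only [Perm.mul_apply, swap_apply_def, Fin.mk.injEq] at hj'
  by_contra hne
  split_ifs at hj' <;> subst_vars <;> omega

/-- Induction along a saturated chain from `σ`: `f` sends covers to covers, and the index of a cover
is the only descent that it creates, so `f` commutes with each step. -/
theorem descentEquiv_apply {n : ℕ} {σ ρ σ' ρ' : Perm (Fin n)} (hσ' : leL σ' ρ')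
    (f : intervalL σ ρ ≃ intervalL σ' ρ')
    (hle : ∀ a b : intervalL σ ρ,
      leL (a : Perm (Fin n)) b ↔ leL (f a : Perm (Fin n)) (f b))
    (hdes : ∀ a : intervalL σ ρ, desL (a : Perm (Fin n)) = desL (f a : Perm (Fin n)))
    (γ : intervalL σ ρ) : (f γ : Perm (Fin n)) = γ * (σ⁻¹ * σ') := by
  suffices H : ∀ δ, leL σ δ → ∀ hδ : δ ∈ intervalL σ ρ,
      (f ⟨δ, hδ⟩ : Perm (Fin n)) = δ * (σ⁻¹ * σ') from H γ γ.2.1 γ.2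
  intro δ h
  induction h with
  | refl =>
    intro hδ
    rw [mul_inv_cancel_left]
    refine leL_antisymm ?_ (f ⟨σ, hδ⟩).2.1
    have := (hle ⟨σ, hδ⟩ (f.symm ⟨σ', leL_refl _, hσ'⟩)).1
      (f.symm ⟨σ', leL_refl _, hσ'⟩).2.1
    simpa using this
  | @tail δ ε hδ hstep ih =>
    intro hε
    obtain ⟨i, hi, hd, rfl⟩ := hstep
    have hcov : leL δ (simple n i * δ) := Relation.ReflTransGen.single ⟨i, hi, hd, rfl⟩
    obtain ⟨h1, h2⟩ := mem_Icc_pred.1 hi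
    have hδ' : δ ∈ intervalL σ ρ := ⟨hδ, leL_trans hcov hε.2⟩
    have ih := ih hδ'
    have hlt := inversions_simple_mul h1 h2 ((not_mem_desL h1 h2).1 hd)
    have hnm := pair_notMem_inversions (σ := δ) h1 h2
    have hle' := (hle ⟨δ, hδ'⟩ ⟨_, hε⟩).1 hcov
    have hne : δ ≠ simple n i * δ := by
      intro he
      rw [← he] at hlt
      exact hnm (hlt ▸ Finset.mem_insert_self _ _)
    rcases Relation.ReflTransGen.cases_head hle' with heq | ⟨η, ⟨j, hj, hjd, rfl⟩, hrest⟩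
    · exact absurd (congrArg Subtype.val (f.injective (Subtype.ext heq))) hne
    · have hstep' : leL (f ⟨δ, hδ'⟩ : Perm (Fin n)) (simple n j * (f ⟨δ, hδ'⟩ : Perm (Fin n))) :=
        Relation.ReflTransGen.single ⟨j, hj, hjd, rfl⟩
      have hη : simple n j * (f ⟨δ, hδ'⟩ : Perm (Fin n)) ∈ intervalL σ' ρ' :=
        ⟨leL_trans (f ⟨δ, hδ'⟩).2.1 hstep', leL_trans hrest (f ⟨_, hε⟩).2.2⟩
      -- The first step of a chain from `f δ` to `f (s_i δ)` is pulled back to an element `θ`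
      -- between `δ` and `s_i δ`. As these differ by one inversion and `θ ≠ δ`, `θ` is `s_i δ`.
      obtain ⟨⟨θ, hθ⟩, hfθ⟩ := f.surjective ⟨_, hη⟩
      have t1 : leL δ θ := (hle ⟨δ, hδ'⟩ ⟨θ, hθ⟩).2 (by rw [hfθ]; exact hstep')
      have t2 : leL θ (simple n i * δ) := (hle ⟨θ, hθ⟩ ⟨_, hε⟩).2 (by rw [hfθ]; exact hrest)
      have hθδ : θ ≠ δ := by
        rintro rfl
        have : (f ⟨θ, hδ'⟩ : Perm (Fin n)) = simple n j * (f ⟨θ, hδ'⟩ : Perm (Fin n)) :=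
          congrArg Subtype.val hfθ
        obtain ⟨k1, k2⟩ := mem_Icc_pred.1 hj
        have hc := card_inversions_simple_mul k1 k2 ((not_mem_desL k1 k2).1 hjd)
        rw [← this] at hc
        omega
      have hθε : θ = simple n i * δ := by
        refine leL_antisymm t2 (leL_iff.2 ?_)
        rw [leL_iff] at t1 t2
        rw [hlt] at t2 ⊢
        refine Finset.insert_subset ?_ t1
        by_contra hnot
        apply hθδ
        apply inversions_injective
        refine (Finset.Subset.antisymm t1 fun p hp => ?_).symm
        rcases Finset.mem_insert.1 (t2 hp) with rfl | hp'
        · exact absurd hp hnot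
        · exact hp'
      subst hθε
      have hval : (f ⟨simple n i * δ, hε⟩ : Perm (Fin n)) =
          simple n j * (f ⟨δ, hδ'⟩ : Perm (Fin n)) := congrArg Subtype.val hfθ
      have hji : j = i := by
        refine eq_of_mem_desL_simple_mul h1 h2 hd ?_ ?_
        · rwa [hdes ⟨δ, hδ'⟩]
        · rw [hdes ⟨_, hε⟩, hval]
          obtain ⟨k1, k2⟩ := mem_Icc_pred.1 hj
          rw [mem_desL k1 k2, (simple_mul_inv_apply _ k1 k2).1, (simple_mul_inv_apply _ k1 k2).2]
          exact (not_mem_desL k1 k2).1 hjd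
      rw [hval, hji, ih, mul_assoc]

/-! ### Fillings by a sequence of boxes -/

section Fillings

variable {D : Finset (ℕ × ℕ)} {n : ℕ}

theorem seqFilling_LRBT_lt_iff (h : D.card = n) (b c : D) :
    seqFilling orderLRBT D h b < seqFilling orderLRBT D h c ↔
      b.1.2 < c.1.2 ∨ b.1.2 = c.1.2 ∧ b.1.1 < c.1.1 := by
  simp [seqFilling_lt_iff, orderLRBT, Prod.Lex.toLex_lt_toLex]

theorem seqFilling_RLBT_lt_iff (h : D.card = n) (b c : D) :
    seqFilling orderRLBT D h b < seqFilling orderRLBT D h c ↔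
      b.1.2 < c.1.2 ∨ b.1.2 = c.1.2 ∧ c.1.1 < b.1.1 := by
  simp [seqFilling_lt_iff, orderRLBT, Prod.Lex.toLex_lt_toLex]

theorem seqFilling_BTLR_lt_iff (h : D.card = n) (b c : D) :
    seqFilling orderBTLR D h b < seqFilling orderBTLR D h c ↔
      b.1.1 < c.1.1 ∨ b.1.1 = c.1.1 ∧ b.1.2 < c.1.2 := by
  simp [seqFilling_lt_iff, orderBTLR, Prod.Lex.toLex_lt_toLex]

theorem seqFilling_TBLR_lt_iff (h : D.card = n) (b c : D) :
    seqFilling orderTBLR D h b < seqFilling orderTBLR D h c ↔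
      b.1.1 < c.1.1 ∨ b.1.1 = c.1.1 ∧ c.1.2 < b.1.2 := by
  simp [seqFilling_lt_iff, orderTBLR, Prod.Lex.toLex_lt_toLex]

theorem seqFilling_BTRL_lt_iff (h : D.card = n) (b c : D) :
    seqFilling orderBTRL D h b < seqFilling orderBTRL D h c ↔
      c.1.1 < b.1.1 ∨ b.1.1 = c.1.1 ∧ b.1.2 < c.1.2 := by
  simp [seqFilling_lt_iff, orderBTRL, Prod.Lex.toLex_lt_toLex]

theorem readWord_eq (o : BoxOrder) (F : StdFilling D n) (h : D.card = n) :
    readWord o F = (seqFilling o D h).symm.trans F := rfl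

/-- Standard fillings that increase towards the upper left. -/
def antiTableaux (D : Finset (ℕ × ℕ)) (n : ℕ) : Set (StdFilling D n) :=
  {T | ∀ b c : D, c.1.1 ≤ b.1.1 → b.1.2 ≤ c.1.2 → T b ≤ T c}

/-- The words of the standard tableaux on `D`, read in the order given by the labelling `lam`. -/
def extWords (lam : StdFilling D n) : Set (Perm (Fin n)) :=
  {σ | lam.trans σ ∈ stdTableaux D n}

theorem mem_stdTableaux {T : StdFilling D n} : T ∈ stdTableaux D n ↔
    ∀ b c : D, b.1.1 ≤ c.1.1 → b.1.2 ≤ c.1.2 → T b ≤ T c := Iff.rfl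

theorem mem_antiTableaux {T : StdFilling D n} : T ∈ antiTableaux D n ↔
    ∀ b c : D, c.1.1 ≤ b.1.1 → b.1.2 ≤ c.1.2 → T b ≤ T c := Iff.rfl

theorem mem_extWords {lam : StdFilling D n} {σ : Perm (Fin n)} :
    σ ∈ extWords lam ↔ lam.trans σ ∈ stdTableaux D n := Iff.rfl

theorem seqFilling_LRBT_mem (h : D.card = n) : seqFilling orderLRBT D h ∈ stdTableaux D n := by
  intro b c h1 h2
  rw [← not_lt, seqFilling_LRBT_lt_iff]
  omega

theorem seqFilling_BTLR_mem (h : D.card = n) : seqFilling orderBTLR D h ∈ stdTableaux D n := by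
  intro b c h1 h2
  rw [← not_lt, seqFilling_BTLR_lt_iff]
  omega

theorem seqFilling_RLBT_mem (h : D.card = n) : seqFilling orderRLBT D h ∈ antiTableaux D n := by
  intro b c h1 h2
  rw [← not_lt, seqFilling_RLBT_lt_iff]
  omega

theorem seqFilling_BTRL_mem (h : D.card = n) : seqFilling orderBTRL D h ∈ antiTableaux D n := by
  intro b c h1 h2
  rw [← not_lt, seqFilling_BTRL_lt_iff]
  omega

/-! ### Words of tableaux as weak order intervals -/

theorem leL_trans_iff (lam S T : StdFilling D n) :
    leL (lam.symm.trans S) (lam.symm.trans T) ↔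
      ∀ b c : D, lam b < lam c → S c < S b → T c < T b := by
  rw [leL_iff_forall]
  constructor
  · intro h b c
    simpa using h (lam b) (lam c)
  · intro h a b
    simpa using h (lam.symm a) (lam.symm b)

theorem mem_desL_trans (lam T : StdFilling D n) {b c : D} (h : (T b : ℕ) + 1 = T c) :
    (T c : ℕ) ∈ desL (lam.symm.trans T) ↔ lam c < lam b := by
  rw [mem_desL (by omega) (T c).2]
  have hb : (⟨(T c : ℕ) - 1, by omega⟩ : Fin n) = T b := Fin.ext (by simp; omega)
  rw [hb]
  change lam (T.symm (T c)) < lam (T.symm (T b)) ↔ _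
  simp

/-- The standard tableau filled along the rows gives the minimum, the one filled along the columns
the maximum. -/
theorem extWords_eq_intervalL (h : D.card = n) {lam : StdFilling D n}
    (hlam : lam ∈ antiTableaux D n) :
    extWords lam = intervalL (lam.symm.trans (seqFilling orderLRBT D h))
      (lam.symm.trans (seqFilling orderBTLR D h)) := by
  ext γ
  -- Every permutation is the word of a unique filling, so membership on both sides becomes a
  -- condition on `T`.
  obtain ⟨T, rfl⟩ : ∃ T : StdFilling D n, lam.symm.trans T = γ := ⟨lam.trans γ, by ext; simp⟩
  have hT : lam.trans (lam.symm.trans T) = T := by ext; simp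
  simp only [intervalL, Set.mem_ofPred_eq, mem_extWords, hT, leL_trans_iff,
    seqFilling_LRBT_lt_iff, seqFilling_BTLR_lt_iff]
  constructor
  · intro hstd
    constructor
    · intro b c hl hs
      by_contra hcon
      have h1 := hstd c b
      have h2 := hlam c b
      have hne : b ≠ c := fun e => by simp [e] at hl
      have hlt : T b < T c := lt_of_le_of_ne (not_lt.1 hcon) (T.injective.ne hne)
      by_cases hx : c.1.1 ≤ b.1.1
      · exact absurd (h1 hx (by omega)) (not_le_of_gt hlt)
      · exact absurd (h2 (by omega) (by omega)) (not_le_of_gt hl)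
    · intro b c hl hs
      have h1 := hstd b c
      have h2 := hlam c b
      by_contra hcon
      by_cases hy : b.1.2 ≤ c.1.2
      · exact absurd (h1 (by omega) hy) (not_le_of_gt hs)
      · exact absurd (h2 (by omega) (by omega)) (not_le_of_gt hl)
  · rintro ⟨hmin, hmax⟩ b c h1 h2
    by_contra hcon
    rw [not_le] at hcon
    -- A violation of standardness is an inversion of the word absent from the column filling if
    -- `lam b < lam c`, and a missing inversion of the row filling if `lam c < lam b`.
    rcases lt_trichotomy (lam b) (lam c) with hl | hl | hl
    · have := hmax b c hl hcon
      omega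
    · rw [lam.injective hl] at hcon
      exact lt_irrefl _ hcon
    · refine lt_asymm hcon (hmin c b hl ?_)
      have hne : (b : ℕ × ℕ) ≠ c := fun e => by simp [Subtype.ext e] at hl
      rw [ne_eq, Prod.ext_iff] at hne
      omega

theorem leL_extWords (h : D.card = n) {lam : StdFilling D n} (hlam : lam ∈ antiTableaux D n) :
    leL (lam.symm.trans (seqFilling orderLRBT D h)) (lam.symm.trans (seqFilling orderBTLR D h)) := by
  have : lam.symm.trans (seqFilling orderLRBT D h) ∈ extWords lam := by
    rw [mem_extWords, ← Equiv.trans_assoc]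
    simpa using seqFilling_LRBT_mem h
  rw [extWords_eq_intervalL h hlam] at this
  exact this.2

theorem extWords_mem_weakInt (h : D.card = n) {lam : StdFilling D n}
    (hlam : lam ∈ antiTableaux D n) : extWords lam ∈ weakInt n :=
  ⟨_, _, leL_extWords h hlam, extWords_eq_intervalL h hlam⟩

theorem intervalLE_extWords (h : D.card = n) {lam mu : StdFilling D n}
    (hlam : lam ∈ antiTableaux D n) (hmu : mu ∈ antiTableaux D n) :
    intervalLE (extWords lam) (extWords mu) ↔
      leL ((seqFilling orderLRBT D h).symm.trans lam)
        ((seqFilling orderLRBT D h).symm.trans mu) := by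
  rw [extWords_eq_intervalL h hlam, extWords_eq_intervalL h hmu,
    intervalLE_iff (leL_extWords h hlam) (leL_extWords h hmu), leR_iff]
  rfl

/-- Relative to the row filling, the right-to-left row filling inverts only pairs within a row, and
every anti-standard labelling inverts those. -/
theorem leL_RLBT (h : D.card = n) {mu : StdFilling D n} (hmu : mu ∈ antiTableaux D n) :
    leL ((seqFilling orderLRBT D h).symm.trans (seqFilling orderRLBT D h))
      ((seqFilling orderLRBT D h).symm.trans mu) := by
  rw [leL_trans_iff]
  intro b c h1 h2
  have hne : c ≠ b := by rintro rfl; exact lt_irrefl _ h1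
  rw [seqFilling_LRBT_lt_iff] at h1
  rw [seqFilling_RLBT_lt_iff] at h2
  exact lt_of_le_of_ne (hmu c b (by omega) (by omega)) (mu.injective.ne hne)

/-- A pair not inverted by the right-to-left column filling has its later box weakly above and to
the left, so no anti-standard labelling inverts it. -/
theorem leL_BTRL (h : D.card = n) {mu : StdFilling D n} (hmu : mu ∈ antiTableaux D n) :
    leL ((seqFilling orderLRBT D h).symm.trans mu)
      ((seqFilling orderLRBT D h).symm.trans (seqFilling orderBTRL D h)) := by
  rw [leL_trans_iff]
  intro b c h1 h2
  rw [seqFilling_LRBT_lt_iff] at h1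
  rw [seqFilling_BTRL_lt_iff]
  by_contra hcon
  exact absurd (hmu b c (by omega) (by omega)) (not_le_of_gt h2)

/-! ### The equivalence class of an interval of tableau words -/

/-- Two boxes, one weakly above and to the right of the other, span a box above the first and to
the left of the second. -/
def CornerClosed (D : Finset (ℕ × ℕ)) : Prop :=
  ∀ b ∈ D, ∀ c ∈ D, b.1 ≤ c.1 → b.2 ≤ c.2 → (b.1, c.2) ∈ D

/-- Boxes in northwest-southeast position are ordered alike by `lam` and `mu`; on the other pairs
`S` and `T` agree because both are standard. -/
theorem leL_trans_of_antiTableaux {lam mu S T : StdFilling D n} (hlam : lam ∈ antiTableaux D n)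
    (hmu : mu ∈ antiTableaux D n) (hS : S ∈ stdTableaux D n) (hT : T ∈ stdTableaux D n)
    (h : leL (lam.symm.trans S) (lam.symm.trans T)) :
    leL (mu.symm.trans S) (mu.symm.trans T) := by
  rw [leL_trans_iff] at h ⊢
  intro b c h1 h2
  have hne : c ≠ b := by rintro rfl; exact lt_irrefl _ h1
  rcases le_total b.1.1 c.1.1 with hx | hx <;> rcases le_total b.1.2 c.1.2 with hy | hy
  · exact absurd (hS b c hx hy) (not_le_of_gt h2)
  · exact absurd (hmu c b hx hy) (not_le_of_gt h1)
  · exact h b c (lt_of_le_of_ne (hlam b c hx hy) (lam.injective.ne hne.symm)) h2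
  · exact lt_of_le_of_ne (hT c b hx hy) (T.injective.ne hne)

theorem lt_of_antiTableaux (hD : CornerClosed D) {lam mu S : StdFilling D n}
    (hlam : lam ∈ antiTableaux D n)
    (hmu : mu ∈ antiTableaux D n) (hS : S ∈ stdTableaux D n) {b c : D} (h : (S b : ℕ) + 1 = S c)
    (hl : lam c < lam b) : mu c < mu b := by
  have hne : c ≠ b := by rintro rfl; exact lt_irrefl _ hl
  have hne' : (c : ℕ × ℕ) ≠ b := fun e => hne (Subtype.ext e)
  rw [ne_eq, Prod.ext_iff] at hne'
  rcases le_total b.1.1 c.1.1 with hx | hx <;> rcases le_total b.1.2 c.1.2 with hy | hy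
  · rcases eq_or_lt_of_le hx with hx' | hx'
    · exact absurd (hlam b c hx'.ge hy) (not_le_of_gt hl)
    · rcases eq_or_lt_of_le hy with hy' | hy'
      · exact lt_of_le_of_ne (hmu c b hx hy'.ge) (mu.injective.ne hne)
      · exfalso
        -- The corner box would carry an entry strictly between the consecutive entries of `b` and
        -- `c`.
        let d : D := ⟨(b.1.1, c.1.2), hD _ b.2 _ c.2 hx hy⟩
        have h1 : S b ≤ S d := hS b d le_rfl hy
        have h2 : S d ≤ S c := hS d c hx le_rfl
        have n1 : b ≠ d := fun e => by
          have := congrArg (fun z : D => z.1.2) e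
          simp only [d] at this
          omega
        have n2 : d ≠ c := fun e => by
          have := congrArg (fun z : D => z.1.1) e
          simp only [d] at this
          omega
        have h1' := lt_of_le_of_ne h1 (S.injective.ne n1)
        have h2' := lt_of_le_of_ne h2 (S.injective.ne n2)
        rw [Fin.lt_def] at h1' h2'
        omega
  · exact lt_of_le_of_ne (hmu c b hx hy) (mu.injective.ne hne)
  · exact absurd (hlam b c hx hy) (not_le_of_gt hl)
  · have := hS c b hx hy
    rw [Fin.le_def] at this
    omega

theorem desL_trans_subset (hD : CornerClosed D) {lam mu S : StdFilling D n}
    (hlam : lam ∈ antiTableaux D n) (hmu : mu ∈ antiTableaux D n) (hS : S ∈ stdTableaux D n) :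
    desL (lam.symm.trans S) ⊆ desL (mu.symm.trans S) := by
  intro i hi
  obtain ⟨h1, h2⟩ := bounds_of_mem_desL hi
  obtain ⟨b, hb⟩ := S.surjective ⟨i - 1, by omega⟩
  obtain ⟨c, hc⟩ := S.surjective ⟨i, h2⟩
  have hi' : i = (S c : ℕ) := by rw [hc]
  have hbc : (S b : ℕ) + 1 = S c := by rw [hb, hc]; simp; omega
  rw [hi', mem_desL_trans _ _ hbc] at hi ⊢
  exact lt_of_antiTableaux hD hlam hmu hS hbc hi

theorem trans_symm_mem_extWords (lam : StdFilling D n) {T : StdFilling D n}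
    (hT : T ∈ stdTableaux D n) : lam.symm.trans T ∈ extWords lam := by
  rw [mem_extWords, ← Equiv.trans_assoc]
  simpa using hT

/-- Changing the labelling of the boxes, as a bijection of sets of words. -/
def relabel (lam mu : StdFilling D n) : extWords lam ≃ extWords mu where
  toFun γ := ⟨mu.symm.trans (lam.trans γ), trans_symm_mem_extWords mu γ.2⟩
  invFun γ := ⟨lam.symm.trans (mu.trans γ), trans_symm_mem_extWords lam γ.2⟩
  left_inv γ := by ext; simp
  right_inv γ := by ext; simp

theorem descentEquiv_extWords (hD : CornerClosed D) {lam mu : StdFilling D n}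
    (hlam : lam ∈ antiTableaux D n) (hmu : mu ∈ antiTableaux D n) :
    descentEquiv (extWords lam) (extWords mu) := by
  have key : ∀ γ : Perm (Fin n), lam.symm.trans (lam.trans γ) = γ := fun γ => by ext; simp
  refine ⟨relabel lam mu, fun a b => ?_, fun a => ?_⟩
  · rw [← key a.1, ← key b.1]
    exact ⟨leL_trans_of_antiTableaux hlam hmu a.2 b.2, leL_trans_of_antiTableaux hmu hlam a.2 b.2⟩
  · rw [← key a.1]
    exact (desL_trans_subset hD hlam hmu a.2).antisymm (desL_trans_subset hD hmu hlam a.2)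

theorem le_of_consecutive (T : StdFilling D n) {α : Type*} [Preorder α] {g : D → α} {b c : D}
    (hbc : T b ≤ T c)
    (h : ∀ d e, T b ≤ T d → T e ≤ T c → (T d : ℕ) + 1 = T e → g d ≤ g e) : g b ≤ g c := by
  have := fin_le_of_consecutive (g := g ∘ T.symm) hbc fun d e h1 h2 h3 =>
    h (T.symm d) (T.symm e) (by simpa) (by simpa) (by simpa)
  simpa using this

/-- Steps of the row filling within a row are descents and make `mu` decrease to the right; steps of
the column filling within a column are non-descents and make `mu` increase upwards. The remaining
pairs are inverted by the column filling relative to the row filling, and comparability of the two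
words settles them. -/
theorem mem_antiTableaux_of_desL (h : D.card = n) {lam mu : StdFilling D n}
    (hlam : lam ∈ antiTableaux D n)
    (hle : leL (mu.symm.trans (seqFilling orderLRBT D h))
      (mu.symm.trans (seqFilling orderBTLR D h)))
    (hsource : desL (lam.symm.trans (seqFilling orderLRBT D h)) =
      desL (mu.symm.trans (seqFilling orderLRBT D h)))
    (hsink : desL (lam.symm.trans (seqFilling orderBTLR D h)) =
      desL (mu.symm.trans (seqFilling orderBTLR D h))) : mu ∈ antiTableaux D n := by
  intro b c hx hy
  rcases eq_or_lt_of_le hy with hy' | hy'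
  · refine le_of_consecutive (seqFilling orderLRBT D h) (g := OrderDual.toDual ∘ mu) (b := c)
      (c := b) (seqFilling_LRBT_mem h _ _ hx hy'.ge) fun d e h1 h2 h3 => ?_
    rw [← not_lt, seqFilling_LRBT_lt_iff] at h1 h2
    have h4 : seqFilling orderLRBT D h d < seqFilling orderLRBT D h e := by
      rw [Fin.lt_def]; omega
    have hne : e ≠ d := by rintro rfl; exact lt_irrefl _ h4
    rw [seqFilling_LRBT_lt_iff] at h4
    have h5 := lt_of_le_of_ne (hlam e d (by omega) (by omega)) (lam.injective.ne hne)
    rw [← mem_desL_trans _ _ h3, hsource, mem_desL_trans _ _ h3] at h5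
    exact OrderDual.toDual_le_toDual.2 h5.le
  · rcases eq_or_lt_of_le hx with hx' | hx'
    · refine le_of_consecutive (seqFilling orderBTLR D h) (g := mu)
        (seqFilling_BTLR_mem h _ _ hx'.ge hy) fun d e h1 h2 h3 => ?_
      rw [← not_lt, seqFilling_BTLR_lt_iff] at h1 h2
      have h4 : seqFilling orderBTLR D h d < seqFilling orderBTLR D h e := by
        rw [Fin.lt_def]; omega
      rw [seqFilling_BTLR_lt_iff] at h4
      have h5 := hlam d e (by omega) (by omega)
      rw [← not_lt, ← mem_desL_trans _ _ h3, hsink, mem_desL_trans _ _ h3, not_lt] at h5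
      exact h5
    · by_contra hcon
      rw [leL_trans_iff] at hle
      have := hle c b (not_le.1 hcon) (by rw [seqFilling_LRBT_lt_iff]; omega)
      rw [seqFilling_BTLR_lt_iff] at this
      omega

theorem exists_antiTableau_of_descentEquiv (h : D.card = n) {lam : StdFilling D n}
    (hlam : lam ∈ antiTableaux D n) {J : Set (Perm (Fin n))} (hJ : J ∈ weakInt n)
    (hequiv : descentEquiv (extWords lam) J) : ∃ mu ∈ antiTableaux D n, J = extWords mu := by
  obtain ⟨σ', ρ', hσ', rfl⟩ := hJ
  rw [extWords_eq_intervalL h hlam] at hequiv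
  obtain ⟨f, hle, hdes⟩ := hequiv
  have happ := descentEquiv_apply hσ' f hle hdes
  generalize (lam.symm.trans (seqFilling orderLRBT D h))⁻¹ * σ' = ξ at happ
  -- Multiplying all words by `ξ` on the right is the same as reading them off the labels `ξ⁻¹ ∘
  -- lam`.
  let mu : StdFilling D n := lam.trans ξ⁻¹
  have hmul : ∀ T : StdFilling D n, mu.symm.trans T = (lam.symm.trans T) * ξ := fun T => rfl
  have hmin := extWords_eq_intervalL h hlam ▸
    trans_symm_mem_extWords lam (seqFilling_LRBT_mem h)
  have hmax := extWords_eq_intervalL h hlam ▸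
    trans_symm_mem_extWords lam (seqFilling_BTLR_mem h)
  refine ⟨mu, mem_antiTableaux_of_desL h hlam ?_ ?_ ?_, ?_⟩
  · have := (hle ⟨_, hmin⟩ ⟨_, hmax⟩).1 (leL_extWords h hlam)
    rwa [happ, happ, ← hmul, ← hmul] at this
  · have := hdes ⟨_, hmin⟩
    rwa [happ, ← hmul] at this
  · have := hdes ⟨_, hmax⟩
    rwa [happ, ← hmul] at this
  · have hmem : ∀ τ, τ ∈ extWords mu ↔ τ * ξ⁻¹ ∈ extWords lam := fun τ => Iff.rfl
    ext τ
    rw [hmem, extWords_eq_intervalL h hlam]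
    constructor
    · intro hτ
      obtain ⟨γ, hγ⟩ := f.surjective ⟨τ, hτ⟩
      have := happ γ
      rw [hγ] at this
      rw [show τ = γ * ξ from this, mul_inv_cancel_right]
      exact γ.2
    · intro hτ
      have := happ ⟨_, hτ⟩
      rw [inv_mul_cancel_right] at this
      exact this ▸ (f ⟨_, hτ⟩).2

theorem equivClass_extWords (hD : CornerClosed D) (h : D.card = n) {lam : StdFilling D n}
    (hlam : lam ∈ antiTableaux D n) :
    equivClass (extWords lam) = {I | ∃ mu ∈ antiTableaux D n, I = extWords mu} := by
  ext J
  constructor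
  · rintro ⟨hJ, hequiv⟩
    exact exists_antiTableau_of_descentEquiv h hlam hJ hequiv
  · rintro ⟨mu, hmu, rfl⟩
    exact ⟨extWords_mem_weakInt h hmu, descentEquiv_extWords hD hlam hmu⟩

/-! ### The reflected transposed diagram -/

/-- Transposition as a bijection of boxes. -/
def transposeEquiv (D : Finset (ℕ × ℕ)) : D ≃ transposeDiagram D where
  toFun b := ⟨b.1.swap, Finset.mem_image_of_mem _ b.2⟩
  invFun c := ⟨c.1.swap, by
    obtain ⟨b, hb, hc⟩ := Finset.mem_image.1 c.2
    rwa [← hc, Prod.swap_swap]⟩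
  left_inv b := by simp
  right_inv c := by simp

theorem reflectEquiv_fst (b : D) : (reflectEquiv D b : ℕ × ℕ).1 = b.1.1 := rfl

theorem reflectEquiv_snd_le_iff (b c : D) :
    (reflectEquiv D b : ℕ × ℕ).2 ≤ (reflectEquiv D c : ℕ × ℕ).2 ↔ c.1.2 ≤ b.1.2 := by
  have h1 : b.1.2 ≤ D.sup Prod.snd := Finset.le_sup (f := Prod.snd) b.2
  have h2 : c.1.2 ≤ D.sup Prod.snd := Finset.le_sup (f := Prod.snd) c.2
  simp only [reflectEquiv_apply, flipBox]
  omega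

/-- The bijection between the boxes of `D` and those of its reflected transpose. -/
noncomputable def quarterTurn (D : Finset (ℕ × ℕ)) : D ≃ reflectX (transposeDiagram D) :=
  (transposeEquiv D).trans (reflectEquiv _)

theorem quarterTurn_fst (b : D) : (quarterTurn D b : ℕ × ℕ).1 = b.1.2 := rfl

theorem quarterTurn_snd_le_iff (b c : D) :
    (quarterTurn D b : ℕ × ℕ).2 ≤ (quarterTurn D c : ℕ × ℕ).2 ↔ c.1.1 ≤ b.1.1 :=
  reflectEquiv_snd_le_iff _ _

theorem quarterTurn_trans_mem_iff {T : StdFilling (reflectX (transposeDiagram D)) n} :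
    (quarterTurn D).trans T ∈ antiTableaux D n ↔
      T ∈ stdTableaux (reflectX (transposeDiagram D)) n := by
  rw [mem_antiTableaux, mem_stdTableaux, (quarterTurn D).surjective.forall₂]
  refine forall₂_congr fun b c => ?_
  rw [quarterTurn_snd_le_iff, quarterTurn_fst, quarterTurn_fst]
  exact imp.swap

/-- The second reflection undoes the reversal of rows made by the first, and the remaining
transposition does not affect the coordinatewise order. -/
theorem linExt_fillingPoset (T : StdFilling (reflectX (transposeDiagram D)) n) :
    linExt (fillingPoset (reflectFilling T)) = extWords ((quarterTurn D).trans T) := by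
  ext σ
  rw [mem_extWords, mem_stdTableaux]
  simp only [linExt, Set.mem_ofPred_eq]
  rw [((quarterTurn D).trans T).surjective.forall₂]
  refine forall₂_congr fun b c => ?_
  have hle : (fillingPoset (reflectFilling T)).le ((quarterTurn D).trans T b)
      ((quarterTurn D).trans T c) ↔ c.1.1 ≥ b.1.1 ∧ b.1.2 ≤ c.1.2 := by
    change (((reflectFilling T).symm (T (quarterTurn D b)) : _) : ℕ × ℕ) ≤
      (((reflectFilling T).symm (T (quarterTurn D c)) : _) : ℕ × ℕ) ↔ _
    simp only [reflectFilling, Equiv.symm_trans_apply, Equiv.symm_symm, Equiv.symm_apply_apply]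
    rw [Prod.le_def, reflectEquiv_snd_le_iff, quarterTurn_snd_le_iff, reflectEquiv_fst,
      reflectEquiv_fst, quarterTurn_fst, quarterTurn_fst, and_comm]
  rw [hle]
  simp only [Equiv.trans_apply, ge_iff_le, and_imp]

theorem seqFilling_quarterTurn (h : D.card = n)
    (h' : (reflectX (transposeDiagram D)).card = n) :
    (quarterTurn D).trans (seqFilling orderTBLR (reflectX (transposeDiagram D)) h') =
      seqFilling orderLRBT D h := by
  have key : (seqFilling orderLRBT D h).symm.trans ((quarterTurn D).trans
      (seqFilling orderTBLR (reflectX (transposeDiagram D)) h')) = (1 : Perm (Fin n)) := by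
    refine perm_eq_one_of_strictMono fun a b hab => ?_
    obtain ⟨x, rfl⟩ := (seqFilling orderLRBT D h).surjective a
    obtain ⟨y, rfl⟩ := (seqFilling orderLRBT D h).surjective b
    simp only [Equiv.trans_apply, Equiv.symm_apply_apply]
    rw [seqFilling_LRBT_lt_iff] at hab
    rw [seqFilling_TBLR_lt_iff, ← not_le (a := (quarterTurn D x : ℕ × ℕ).2),
      quarterTurn_snd_le_iff, quarterTurn_fst, quarterTurn_fst]
    omega
  ext x
  have := DFunLike.congr_fun key (seqFilling orderLRBT D h x)
  simp only [Equiv.trans_apply, Equiv.symm_apply_apply, Perm.one_apply] at this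
  simp only [Equiv.trans_apply, this]

theorem readWord_TBLR (h : D.card = n) (T : StdFilling (reflectX (transposeDiagram D)) n) :
    readWord orderTBLR T =
      (seqFilling orderLRBT D h).symm.trans ((quarterTurn D).trans T) := by
  rw [readWord_eq _ _ T.card_eq, ← seqFilling_quarterTurn h T.card_eq]
  ext
  simp

end Fillings

/-! ### The longest elements `w₀` and `w₁` -/

section Longest

variable {n : ℕ} {S : Set ℕ} {κ : Fin n → ℕ}

theorem block_apply_of_mem_parabolic
    (hS : ∀ d e : Fin n, (d : ℕ) + 1 = e → ((e : ℕ) ∈ S ↔ κ d ≠ κ e)) {w : Perm (Fin n)}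
    (hw : w ∈ parabolic n (Set.Icc 1 (n - 1) \ S)) : ∀ a, κ (w a) = κ a := by
  refine Subgroup.closure_induction (p := fun w _ => ∀ a, κ (w a) = κ a) ?_ ?_ ?_ ?_ hw
  · rintro _ ⟨i, ⟨hi, hiS⟩, rfl⟩ a
    obtain ⟨h1, h2⟩ := mem_Icc_pred.1 hi
    have := (hS ⟨i - 1, by omega⟩ ⟨i, h2⟩ (by simp; omega)).not.1 hiS
    rw [not_not] at this
    rw [simple_eq h1 h2, swap_apply_def]
    split_ifs with ha hb
    · rw [ha, this]
    · rw [hb, this]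
    · rfl
  · intro a; rfl
  · intro x y _ _ hx hy a
    rw [Perm.mul_apply, hx, hy]
  · intro x _ hx a
    rw [← hx (x⁻¹ a), perm_apply_inv]

/-- Here `κ` is the block index and `S` the set of its jumps. The parabolic subgroup preserves
blocks, so inversions occur only within them; an ascent within a block could be removed by a simple
transposition of the subgroup, which would lengthen the element. -/
theorem w0_eq (hκ : Monotone κ)
    (hS : ∀ d e : Fin n, (d : ℕ) + 1 = e → ((e : ℕ) ∈ S ↔ κ d ≠ κ e)) {v : Perm (Fin n)}
    (hv : ∀ a b, a < b → (v b < v a ↔ κ a = κ b)) : w0 n (Set.Icc 1 (n - 1) \ S) = v := by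
  have hspec := (exists_longest (parabolic n (Set.Icc 1 (n - 1) \ S) : Set (Perm (Fin n)))
    ⟨1, (parabolic n _).one_mem⟩).choose_spec
  change w0 n (Set.Icc 1 (n - 1) \ S) ∈ _ ∧ ∀ v ∈ _, len v ≤ len (w0 n _) at hspec
  generalize w0 n (Set.Icc 1 (n - 1) \ S) = w at hspec
  obtain ⟨hw, hmax⟩ := hspec
  have hblock := block_apply_of_mem_parabolic hS hw
  apply inversions_injective
  ext ⟨a, b⟩
  rw [mem_inversions, mem_inversions]
  refine and_congr_right fun hab => ?_
  rw [hv a b hab]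
  constructor
  · intro hlt
    have := hκ hlt.le
    rw [hblock, hblock] at this
    exact le_antisymm (hκ hab.le) this
  · intro heq
    have : OrderDual.toDual (w a) ≤ OrderDual.toDual (w b) := by
      refine fin_le_of_consecutive (g := OrderDual.toDual ∘ w) hab.le fun d e had heb hde => ?_
      have hκde : κ d = κ e := by
        have h1 := hκ had
        have h2 := hκ heb
        have h3 := hκ (show d ≤ e by rw [Fin.le_def]; omega)
        omega
      refine OrderDual.toDual_le_toDual.2 (not_lt.1 fun hlt => ?_)
      have heS : (e : ℕ) ∉ S := by
        rw [hS d e hde, not_not]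
        exact hκde
      have heI : (e : ℕ) ∈ Set.Icc 1 (n - 1) := mem_Icc_pred.2 ⟨by omega, e.2⟩
      have hmem : w * simple n e ∈ parabolic n (Set.Icc 1 (n - 1) \ S) :=
        mul_mem hw (Subgroup.subset_closure ⟨e, ⟨heI, heS⟩, rfl⟩)
      have hle := hmax _ hmem
      have hdes : (e : ℕ) ∉ desL w⁻¹ := by
        rw [not_mem_desL (by omega) e.2, inv_inv]
        have hd : (⟨(e : ℕ) - 1, by omega⟩ : Fin n) = d := Fin.ext (by simp; omega)
        rw [hd]
        exact hlt
      have hcard := card_inversions_simple_mul (by omega) e.2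
        ((not_mem_desL (by omega) e.2).1 hdes)
      rw [← len_inv, ← len_inv w, mul_inv_rev, simple_inv, len_eq_card_inversions,
        len_eq_card_inversions] at hle
      omega
    exact lt_of_le_of_ne (OrderDual.toDual_le_toDual.1 this) (w.injective.ne hab.ne')

/-- An element with all right descents in `S` increases on each block, so its inversions are among
those of `u`; since `u` itself is admissible, the longest one is `u`. -/
theorem w1_eq (hκ : Monotone κ)
    (hS : ∀ d e : Fin n, (d : ℕ) + 1 = e → ((e : ℕ) ∈ S ↔ κ d ≠ κ e)) {u : Perm (Fin n)}
    (hu : ∀ a b, a < b → (u b < u a ↔ κ a ≠ κ b)) : w1 n S = u := by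
  have hspec := (exists_longest (minReps n (Set.Icc 1 (n - 1) \ S))
    ⟨1, one_mem_minReps n _⟩).choose_spec
  change w1 n S ∈ _ ∧ ∀ v ∈ _, len v ≤ len (w1 n S) at hspec
  generalize w1 n S = z at hspec
  obtain ⟨hz, hmax⟩ := hspec
  have humem : u ∈ minReps n (Set.Icc 1 (n - 1) \ S) := by
    intro i hi
    have hiI := hi.1
    obtain ⟨h1, h2⟩ := mem_Icc_pred.1 hiI
    refine ⟨hiI, fun hcon => hcon.2 ?_⟩
    rw [mem_desR h1 h2, hu _ _ (by rw [Fin.lt_def]; simp; omega)] at hi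
    exact (hS ⟨i - 1, by omega⟩ ⟨i, h2⟩ (by simp; omega)).2 hi
  have hsub : inversions z ⊆ inversions u := by
    rintro ⟨a, b⟩ hab
    rw [mem_inversions] at hab ⊢
    refine ⟨hab.1, (hu a b hab.1).2 fun heq => absurd ?_ (not_le_of_gt hab.2)⟩
    refine fin_le_of_consecutive hab.1.le fun d e had heb hde => not_lt.1 fun hlt => ?_
    have hd : (⟨(e : ℕ) - 1, by omega⟩ : Fin n) = d := Fin.ext (by simp; omega)
    have hdes : (e : ℕ) ∈ desR z := by
      rw [mem_desR (by omega) e.2, hd]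
      exact hlt
    have h4 := hz hdes
    have heS : (e : ℕ) ∈ S := by
      by_contra hcon
      exact h4.2 ⟨h4.1, hcon⟩
    rw [hS d e hde] at heS
    have h1 := hκ had
    have h2 := hκ heb
    have h3 := hκ (show d ≤ e by rw [Fin.le_def]; omega)
    omega
  have hle := hmax u humem
  rw [len_eq_card_inversions, len_eq_card_inversions] at hle
  exact inversions_injective (Finset.eq_of_subset_of_card_le hsub hle)

end Longest

/-! ### Partial sums of block sizes -/

section Blocks

variable {D : Finset (ℕ × ℕ)} {n : ℕ}

/-- Boxes satisfying a property closed downwards for `F` carry an initial segment of the labels. -/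
theorem lt_card_filter_iff (F : StdFilling D n) {p : ℕ × ℕ → Prop} [DecidablePred p]
    (hp : ∀ b c : D, F b ≤ F c → p c → p b) (b : D) : (F b : ℕ) < (D.filter p).card ↔ p b := by
  have hcard : ((Finset.univ.filter fun c : D => p c).map F.toEmbedding).card =
      (D.filter p).card := by
    rw [Finset.card_map, ← Finset.card_map (Function.Embedding.subtype _)]
    congr 1
    ext x
    simp only [Finset.mem_map, Finset.mem_filter, Finset.mem_univ, true_and,
      Function.Embedding.subtype_apply]
    exact ⟨fun ⟨c, hc, hx⟩ => hx ▸ ⟨c.2, hc⟩, fun hx => ⟨⟨x, hx.1⟩, hx.2, rfl⟩⟩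
  rw [← hcard]
  constructor
  · intro hlt
    by_contra hb
    have hsub : (Finset.univ.filter fun c : D => p c).map F.toEmbedding ⊆ Finset.Iio (F b) := by
      intro i hi
      obtain ⟨c, hc, rfl⟩ := Finset.mem_map.1 hi
      rw [Finset.mem_Iio]
      by_contra hcon
      exact hb (hp b c (not_lt.1 hcon) (Finset.mem_filter.1 hc).2)
    have := Finset.card_le_card hsub
    rw [Fin.card_Iio] at this
    omega
  · intro hb
    have hsub : Finset.Iic (F b) ⊆ (Finset.univ.filter fun c : D => p c).map F.toEmbedding := by
      intro i hi
      obtain ⟨c, rfl⟩ := F.surjective i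
      exact Finset.mem_map.2 ⟨c, by simpa using hp c b (Finset.mem_Iic.1 hi) hb, rfl⟩
    have := Finset.card_le_card hsub
    rw [Fin.card_Iic] at this
    omega

theorem card_filter_lt_eq_sum_take {g : ℕ × ℕ → ℕ} {L : List ℕ}
    (hL : ∀ k (hk : k < L.length), (D.filter fun b => g b = k).card = L[k]) (k : ℕ)
    (hk : k ≤ L.length) : (D.filter fun b => g b < k).card = (L.take k).sum := by
  induction k with
  | zero => simp
  | succ k ih =>
    rw [List.sum_take_succ L k (by omega), ← ih (by omega), ← hL k (by omega),
      ← Finset.card_union_of_disjoint, ← Finset.filter_or]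
    · congr 1
      ext b
      simp only [Finset.mem_filter, Nat.lt_succ_iff_lt_or_eq]
    · rw [Finset.disjoint_filter]
      intro b _ h1 h2
      omega

/-- The blocks `g = 0, 1, …` occupy successive runs of labels of sizes `L[0], L[1], …`. Labels start
at `0`, so `F e` is also the number of boxes up to `d`, the index separating `d` from `e`. -/
theorem mem_partialSums_iff (F : StdFilling D n) {g : ℕ × ℕ → ℕ} {L : List ℕ}
    (hL : ∀ k (hk : k < L.length), (D.filter fun b => g b = k).card = L[k])
    (hg : ∀ b ∈ D, g b < L.length) (hmono : ∀ b c : D, F b ≤ F c → g b ≤ g c) {d e : D}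
    (hde : (F d : ℕ) + 1 = F e) : (F e : ℕ) ∈ partialSums L ↔ g d ≠ g e := by
  have key : ∀ k ≤ L.length, ∀ b : D, (F b : ℕ) < (L.take k).sum ↔ g b < k := by
    intro k hk b
    rw [← card_filter_lt_eq_sum_take hL k hk]
    exact lt_card_filter_iff F (p := fun b => g b < k)
      (fun b c hbc hc => (hmono b c hbc).trans_lt hc) b
  constructor
  · rintro ⟨i, _, hi, hs⟩
    have h1 := (key i hi.le d).1 (by omega)
    have h2 := (key i hi.le e).not.1 (by omega)
    omega
  · intro hne
    have hlt : g d < g e := lt_of_le_of_ne (hmono d e (by rw [Fin.le_def]; omega)) hne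
    have he := hg e e.2
    have h1 := (key (g e) he.le d).2 hlt
    have h2 := (key (g e) he.le e).not.2 (lt_irrefl _)
    exact ⟨g e, by omega, he, by omega⟩

end Blocks

/-! ### Composition diagrams -/

section Composition

variable {n : ℕ} (α : Composition n)

theorem mem_compDiagram {α : Composition n} {b : ℕ × ℕ} : b ∈ compDiagram α ↔
    1 ≤ b.1 ∧ 1 ≤ b.2 ∧ ∃ h : b.2 - 1 < α.blocks.length, b.1 ≤ α.blocks[b.2 - 1] := by
  simp only [compDiagram, Finset.mem_image, Finset.mem_univ, true_and, Sigma.exists]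
  constructor
  · rintro ⟨i, a, rfl⟩
    exact ⟨by simp, by simp, i.2, a.2⟩
  · rintro ⟨h1, h2, h, hle⟩
    refine ⟨⟨b.2 - 1, h⟩, ⟨b.1 - 1, ?_⟩, ?_⟩
    · change b.1 - 1 < α.blocks[b.2 - 1]
      omega
    · exact Prod.ext (by simp; omega) (by simp; omega)

theorem cornerClosed_compDiagram : CornerClosed (compDiagram α) := by
  intro b hb c hc h1 _
  rw [mem_compDiagram] at hb hc ⊢
  obtain ⟨hc1, hc2, h, hle⟩ := hc
  exact ⟨hb.1, hc2, h, h1.trans hle⟩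

theorem SET_eq_stdTableaux : SET α = stdTableaux (compDiagram α) n := by
  ext T
  rw [mem_stdTableaux]
  constructor
  · intro hT b c h1 h2
    let d : compDiagram α := ⟨(b.1.1, c.1.2), cornerClosed_compDiagram α _ b.2 _ c.2 h1 h2⟩
    have hbd : T b ≤ T d := by
      rcases eq_or_lt_of_le h2 with h | h
      · rw [show b = d from Subtype.ext (Prod.ext rfl h)]
      · exact ((hT b d).2 rfl h).le
    have hdc : T d ≤ T c := by
      rcases eq_or_lt_of_le h1 with h | h
      · rw [show d = c from Subtype.ext (Prod.ext h rfl)]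
      · exact ((hT d c).1 rfl h).le
    exact hbd.trans hdc
  · intro hT b c
    constructor
    · intro h1 h2
      refine lt_of_le_of_ne (hT b c h2.le h1.le) (T.injective.ne ?_)
      rintro rfl
      exact lt_irrefl _ h2
    · intro h1 h2
      refine lt_of_le_of_ne (hT b c h1.le h2.le) (T.injective.ne ?_)
      rintro rfl
      exact lt_irrefl _ h2

theorem readingWords_eq : readingWords α =
    extWords (seqFilling orderRLBT (compDiagram α) (card_compDiagram α)) := by
  ext σ
  rw [mem_extWords, ← SET_eq_stdTableaux]
  constructor
  · rintro ⟨T, hT, rfl⟩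
    rw [readWord_eq _ _ (card_compDiagram α), ← Equiv.trans_assoc]
    simpa using hT
  · intro hσ
    refine ⟨_, hσ, ?_⟩
    rw [readWord_eq _ _ (card_compDiagram α), ← Equiv.trans_assoc]
    simp

theorem classX_eq : classX α = {I | ∃ mu ∈ antiTableaux (compDiagram α) n, I = extWords mu} := by
  rw [classX, readingWords_eq, equivClass_extWords (cornerClosed_compDiagram α)
    (card_compDiagram α) (seqFilling_RLBT_mem _)]

/-! ### Row and column lengths of the composition diagram -/

theorem card_row_compDiagram (k : ℕ) (hk : k < α.blocks.length) :
    ((compDiagram α).filter fun b => b.2 - 1 = k).card = α.blocks[k] := by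
  rw [← Finset.card_range α.blocks[k]]
  symm
  refine Finset.card_bij (fun i _ => (i + 1, k + 1)) ?_ ?_ ?_
  · intro i hi
    rw [Finset.mem_range] at hi
    rw [Finset.mem_filter, mem_compDiagram]
    exact ⟨⟨by simp, by simp, by simpa using hk, by simpa using hi⟩, by simp⟩
  · intro i _ j _ h
    simpa using h
  · rintro ⟨x, y⟩ hb
    rw [Finset.mem_filter, mem_compDiagram] at hb
    obtain ⟨⟨h1, h2, h, hle⟩, rfl⟩ := hb
    simp only at h1 h2 hle
    refine ⟨x - 1, ?_, ?_⟩
    · rw [Finset.mem_range]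
      simp only
      omega
    · exact Prod.ext (by simp; omega) (by simp; omega)

theorem card_filter_get_eq_countP (L : List ℕ) (p : ℕ → Bool) :
    (Finset.univ.filter fun i : Fin L.length => p L[i]).card = L.countP p := by
  induction L with
  | nil => rfl
  | cons a L ih =>
    have := Fin.card_filter_univ_succ (n := L.length) (fun i => p (a :: L)[i] = true)
    rw [List.countP_cons, ← ih]
    refine this.trans ?_
    split_ifs <;> simp_all

theorem colLen_sortedDiagram (j : ℕ) :
    (sortedDiagram α).colLen j = α.blocks.countP fun m => decide (j < m) := by
  rw [← (List.perm_insertionSort (· ≥ ·) α.blocks).countP_eq, ← card_filter_get_eq_countP,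
    YoungDiagram.colLen_eq_card]
  symm
  refine Finset.card_bij (fun i _ => ((i : ℕ), j)) ?_ ?_ ?_
  · intro i hi
    rw [YoungDiagram.mem_col_iff]
    refine ⟨YoungDiagram.mem_ofRowLens.2 ⟨i.2, ?_⟩, rfl⟩
    simpa using hi
  · intro i _ i' _ h
    simpa [Fin.ext_iff] using h
  · rintro ⟨x, y⟩ hb
    rw [YoungDiagram.mem_col_iff] at hb
    obtain ⟨hb, rfl⟩ := hb
    obtain ⟨h, hlt⟩ := YoungDiagram.mem_ofRowLens.1 hb
    exact ⟨⟨x, h⟩, by simpa using hlt, rfl⟩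

theorem card_column_compDiagram (j : ℕ) :
    ((compDiagram α).filter fun b => b.1 = j + 1).card = (sortedDiagram α).colLen j := by
  rw [colLen_sortedDiagram, ← card_filter_get_eq_countP]
  symm
  refine Finset.card_bij (fun i _ => (j + 1, (i : ℕ) + 1)) ?_ ?_ ?_
  · intro i hi
    rw [Finset.mem_filter, mem_compDiagram]
    exact ⟨⟨by simp, by simp, by simp, by simpa using hi⟩, rfl⟩
  · intro i _ i' _ h
    simpa [Fin.ext_iff] using h
  · rintro ⟨x, y⟩ hb
    rw [Finset.mem_filter, mem_compDiagram] at hb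
    obtain ⟨⟨_, h2, h, hle⟩, rfl⟩ := hb
    refine ⟨⟨y - 1, h⟩, by simpa using hle, ?_⟩
    exact Prod.ext rfl (by simp at h2 ⊢; omega)

theorem length_conjRev : (conjRev α).length = (sortedDiagram α).rowLen 0 := by
  rw [conjRev, List.length_reverse, YoungDiagram.length_rowLens, YoungDiagram.colLen_transpose]

theorem getElem_conjRev (k : ℕ) (hk : k < (conjRev α).length) :
    (conjRev α)[k] = (sortedDiagram α).colLen ((sortedDiagram α).rowLen 0 - 1 - k) := by
  simp only [conjRev, List.getElem_reverse, YoungDiagram.rowLens, List.getElem_map,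
    List.getElem_range, List.length_map, List.length_range, YoungDiagram.rowLen_transpose,
    YoungDiagram.colLen_transpose]

theorem fst_le_rowLen {b : ℕ × ℕ} (hb : b ∈ compDiagram α) :
    1 ≤ b.1 ∧ b.1 ≤ (sortedDiagram α).rowLen 0 := by
  have h1 := (mem_compDiagram.1 hb).1
  refine ⟨h1, ?_⟩
  have hpos : 0 < (sortedDiagram α).colLen (b.1 - 1) := by
    rw [← card_column_compDiagram]
    exact Finset.card_pos.2 ⟨b, Finset.mem_filter.2 ⟨hb, by omega⟩⟩
  have := YoungDiagram.mem_iff_lt_rowLen.1 (YoungDiagram.mem_iff_lt_colLen.2 hpos)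
  omega

/-- The two fillings visit the rows in the same order and each row in opposite directions, so
exactly the pairs within a row are inverted. -/
theorem w0_partialSums (n : ℕ) (α : Composition n) :
    w0 n (Set.Icc 1 (n - 1) \ partialSums α.blocks) =
      (seqFilling orderRLBT (compDiagram α) (card_compDiagram α)).symm.trans
        (seqFilling orderLRBT (compDiagram α) (card_compDiagram α)) := by
  set F := seqFilling orderRLBT (compDiagram α) (card_compDiagram α) with hF
  have hmono : ∀ b c, F b ≤ F c → b.1.2 - 1 ≤ c.1.2 - 1 := by
    intro b c h
    rw [← not_lt, seqFilling_RLBT_lt_iff] at h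
    omega
  refine w0_eq (κ := fun a => (F.symm a).1.2 - 1) ?_ ?_ ?_
  · intro a b hab
    exact hmono _ _ (by simpa using hab)
  · intro d e hde
    have := mem_partialSums_iff F (g := fun b => b.2 - 1) (card_row_compDiagram α)
      (fun b hb => (mem_compDiagram.1 hb).2.2.1) hmono (d := F.symm d) (e := F.symm e)
      (by simpa using hde)
    simpa using this
  · intro a b
    obtain ⟨x, rfl⟩ := F.surjective a
    obtain ⟨y, rfl⟩ := F.surjective b
    simp only [Equiv.trans_apply, Equiv.symm_apply_apply]
    intro hab
    rw [seqFilling_RLBT_lt_iff] at hab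
    rw [seqFilling_LRBT_lt_iff]
    have hx := (mem_compDiagram.1 x.2).2.1
    have hy := (mem_compDiagram.1 y.2).2.1
    omega

/-- The two fillings visit each column upwards and the columns in opposite orders, so exactly the
pairs in different columns are inverted. -/
theorem w1_partialSums (n : ℕ) (α : Composition n) :
    w1 n (partialSums (conjRev α)) =
      (seqFilling orderBTRL (compDiagram α) (card_compDiagram α)).symm.trans
        (seqFilling orderBTLR (compDiagram α) (card_compDiagram α)) := by
  set F := seqFilling orderBTRL (compDiagram α) (card_compDiagram α) with hF
  set R := (sortedDiagram α).rowLen 0 with hR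
  have hmono : ∀ b c, F b ≤ F c → R - b.1.1 ≤ R - c.1.1 := by
    intro b c h
    rw [← not_lt, seqFilling_BTRL_lt_iff] at h
    omega
  refine w1_eq (κ := fun a => R - (F.symm a).1.1) ?_ ?_ ?_
  · intro a b hab
    exact hmono _ _ (by simpa using hab)
  · intro d e hde
    have := mem_partialSums_iff F (g := fun b => R - b.1) (L := conjRev α) ?_ ?_ hmono
      (d := F.symm d) (e := F.symm e) (by simpa using hde)
    · simpa using this
    · intro k hk
      -- Counted from `0`, block `k` is column `R - k`; all columns lie between `1` and `R`, so
      -- truncated subtraction loses nothing.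
      rw [getElem_conjRev, ← card_column_compDiagram]
      rw [length_conjRev] at hk
      congr 1
      refine Finset.filter_congr fun b hb => ?_
      have := fst_le_rowLen α hb
      omega
    · intro b hb
      have := fst_le_rowLen α hb
      rw [length_conjRev]
      omega
  · intro a b
    obtain ⟨x, rfl⟩ := F.surjective a
    obtain ⟨y, rfl⟩ := F.surjective b
    simp only [Equiv.trans_apply, Equiv.symm_apply_apply]
    intro hab
    rw [seqFilling_BTRL_lt_iff] at hab
    rw [seqFilling_BTLR_lt_iff]
    have hx := fst_le_rowLen α x.2
    have hy := fst_le_rowLen α y.2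
    omega

/-- The intervals of the class are labelled by the standard tableaux on the reflected transpose. -/
theorem classX_eq_linExt : classX α =
    {I | ∃ T ∈ stdTableaux (reflectX (transposeDiagram (compDiagram α))) n,
      I = linExt (fillingPoset (reflectFilling T))} := by
  rw [classX_eq]
  ext I
  constructor
  · rintro ⟨mu, hmu, rfl⟩
    have heq : (quarterTurn (compDiagram α)).trans ((quarterTurn _).symm.trans mu) = mu := by
      ext; simp
    refine ⟨(quarterTurn _).symm.trans mu, quarterTurn_trans_mem_iff.1 ?_, ?_⟩
    · rwa [heq]
    · rw [linExt_fillingPoset, heq]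
  · rintro ⟨T, hT, rfl⟩
    exact ⟨_, quarterTurn_trans_mem_iff.2 hT, linExt_fillingPoset T⟩

theorem tableauLE_iff_intervalLE
    {T U : StdFilling (reflectX (transposeDiagram (compDiagram α))) n}
    (hT : T ∈ stdTableaux _ n) (hU : U ∈ stdTableaux _ n) :
    tableauLE T U ↔ intervalLE (linExt (fillingPoset (reflectFilling T)))
      (linExt (fillingPoset (reflectFilling U))) := by
  rw [linExt_fillingPoset, linExt_fillingPoset, intervalLE_extWords (card_compDiagram α)
    (quarterTurn_trans_mem_iff.2 hT) (quarterTurn_trans_mem_iff.2 hU), tableauLE,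
    readWord_TBLR (card_compDiagram α), readWord_TBLR (card_compDiagram α)]

theorem tableauLE_antisymm {D : Finset (ℕ × ℕ)} {T U : StdFilling D n} (h1 : tableauLE T U)
    (h2 : tableauLE U T) : T = U := by
  have h := leL_antisymm h1 h2
  rw [readWord_eq _ _ T.card_eq, readWord_eq _ _ T.card_eq] at h
  ext b
  simpa using congrArg Fin.val (DFunLike.congr_fun h (seqFilling orderTBLR D T.card_eq b))

theorem tableauLE_refl {D : Finset (ℕ × ℕ)} (T : StdFilling D n) : tableauLE T T := leL_refl _

end Composition

end ExtendedSchur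

/-! ### Proof of the proposition -/

open ExtendedSchur
theorem mainTheorem7 (n : ℕ) (hn : 0 < n) (α : Composition n) :
    -- the reading words form a weak Bruhat interval, whose class is `classX α`
    readingWords α ∈ weakInt n ∧
    -- description of the class, with `E = cd(α)^t`
    classX α = {I | ∃ T ∈ stdTableaux (reflectX (transposeDiagram (compDiagram α))) n,
      I = linExt (fillingPoset (reflectFilling T))} ∧
    -- minimum and maximum
    IsMinOf (classX α)
      (intervalL (w0 n (Set.Icc 1 (n - 1) \ partialSums α.blocks))
        (readWord orderRLBT (sinkSET α))) ∧
    IsMaxOf (classX α)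
      (intervalL (readWord orderBTRL (sourceSET α)) (w1 n (partialSums (conjRev α)))) ∧
    -- isomorphism of posets
    ∃ φ : stdTableaux (reflectX (transposeDiagram (compDiagram α))) n ≃ classX α,
      ∀ T U, tableauLE T.1 U.1 ↔ intervalLE (φ T).1 (φ U).1 := by
  have hcard := card_compDiagram α
  refine ⟨?_, classX_eq_linExt α, ?_, ?_, ?_⟩
  · rw [readingWords_eq]
    exact extWords_mem_weakInt hcard (seqFilling_RLBT_mem hcard)
  · have heq := extWords_eq_intervalL hcard (seqFilling_RLBT_mem hcard)
    rw [w0_partialSums, readWord_eq _ _ hcard, sinkSET, ← heq, classX_eq]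
    refine ⟨⟨_, seqFilling_RLBT_mem hcard, rfl⟩, ?_⟩
    rintro _ ⟨mu, hmu, rfl⟩
    rw [intervalLE_extWords hcard (seqFilling_RLBT_mem hcard) hmu]
    exact leL_RLBT hcard hmu
  · have heq := extWords_eq_intervalL hcard (seqFilling_BTRL_mem hcard)
    rw [w1_partialSums, readWord_eq _ _ hcard, sourceSET, ← heq, classX_eq]
    refine ⟨⟨_, seqFilling_BTRL_mem hcard, rfl⟩, ?_⟩
    rintro _ ⟨mu, hmu, rfl⟩
    rw [intervalLE_extWords hcard hmu (seqFilling_BTRL_mem hcard)]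
    exact leL_BTRL hcard hmu
  · have hmem : ∀ T : stdTableaux (reflectX (transposeDiagram (compDiagram α))) n,
        linExt (fillingPoset (reflectFilling T.1)) ∈ classX α := fun T => by
      rw [classX_eq_linExt]
      exact ⟨T.1, T.2, rfl⟩
    refine ⟨Equiv.ofBijective (fun T => ⟨_, hmem T⟩) ⟨fun T U h => ?_, fun I => ?_⟩,
      fun T U => tableauLE_iff_intervalLE α T.2 U.2⟩
    · have h' : linExt (fillingPoset (reflectFilling T.1)) =
          linExt (fillingPoset (reflectFilling U.1)) := congrArg Subtype.val h
      -- Equal intervals are comparable both ways by reflexivity, so injectivity follows from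
      -- antisymmetry of the tableau order.
      have h1 := (tableauLE_iff_intervalLE α T.2 T.2).1 (tableauLE_refl T.1)
      refine Subtype.ext (tableauLE_antisymm ((tableauLE_iff_intervalLE α T.2 U.2).2 ?_)
        ((tableauLE_iff_intervalLE α U.2 T.2).2 ?_))
      · rwa [← h']
      · rwa [← h']
    · obtain ⟨T, hT, hTI⟩ := (classX_eq_linExt α).subset I.2
      exact ⟨⟨T, hT⟩, Subtype.ext hTI.symm⟩
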